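/- **Setting.** Fix countable disjoint sets $\mathcal{DV}$ and $\mathcal{RV}$ of deterministic and random variables, each variable carrying a type with a countable set of values; there is a type of booleans $\{\mathit{tt},\mathit{ff}\}$. For $S\subseteq\mathcal{DV}$ and $T\subseteq\mathcal{RV}$ let $\mathbf{DetM}[S]$ and $\mathbf{RanM}[T]$ be the sets of (well-typed) memories with domain $S$ and $T$, and let $\mathbf D(A)$ be the set of discrete probability distributions on $A$. Well-typed deterministic expressions $e_d$ are built from deterministic variables, the boolean constants and finitary operators with a fixed interpretation; randomized expressions $e_r$ are built from deterministic expressions, random variables and operators. Commands are $$c ::= \mathbf{skip}\mid x_d\leftarrow e_d\mid x_r\leftarrow e_r\mid x_r\xleftarrow{\$}\mathbf U_S\mid c;c'\mid \mathbf{if}_D\,b\,\mathbf{then}\,c\,\mathbf{else}\,c'\mid \mathbf{if}_R\,b\,\mathbf{then}\,c\,\mathbf{else}\,c'\mid\mathbf{while}_D\,b\,\mathbf{do}\,c ,$$ where $S$ is finite and nonempty, guards of $\mathbf{if}_D$ and $\mathbf{while}_D$ are deterministic boolean expressions, the guard of $\mathbf{if}_R$ is a randomized boolean expression, and the branches of $\mathbf{if}_R$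 contain no assignments to deterministic variables. **Semantics.** $[\![c]\!]$ maps a full configuration $(\sigma,\mu)\in\mathbf{DetM}[\mathcal{DV}]\times\mathbf D(\mathbf{RanM}[\mathcal{RV}])$ to a full configuration (a partial map, undefined if $c$ does not terminate). Deterministic assignments update $\sigma$; random assignments and samplings push $\mu$ forward through $m\mapsto m[x_r\mapsto [\![e_r]\!](\sigma,m)]$, respectively through $m\mapsto m[x_r\mapsto u]$ with $u$ uniform on $S$; sequencing, $\mathbf{if}_D$ and $\mathbf{while}_D$ are as usual; $[\![\mathbf{if}_R\,b\,\mathbf{then}\,c\,\mathbf{else}\,c']\!](\sigma,\mu)$ is the convex combination, with weight $\rho=\mu([\![b]\!]\sigma=\mathit{tt})$, of $[\![c]\!](\sigma,\mu\mid b=\mathit{tt})$ and $[\![c']\!](\sigma,\mu\mid b=\mathit{ff})$ (only the first if $\rho=1$, only the second if $\rho=0$). **Formulas.** The atoms are $\mathbf U_S[e_r]$ ($S$ finite and nonempty), $e_r\sim e_r'$, $e_d=e_d'$ and $p(e_d,\dots)$ for interpreted predicates $p$ (such as $\le$); formulas are closed under $\top,\bot,\wedge,\vee,\to,*,-\!\!*$.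 They are interpreted in worlds $(\sigma,\mu)\in\mathbf{DetM}[S]\times\mathbf D(\mathbf{RanM}[T])$, with $S,T$ arbitrary. Write $(\sigma,\mu)\sqsubseteq(\sigma',\mu')$ if $\sigma$ is a restriction of $\sigma'$ and $\mu$ is a marginal of $\mu'$. The product $(\sigma,\mu)\circ(\sigma',\mu')=(\sigma\cup\sigma',\mu\otimes\mu')$ is defined when $\sigma,\sigma'$ agree on their common domain and the domains of $\mu,\mu'$ are disjoint. An atom holds in $(\sigma,\mu)$ only if its free variables are in the domain of $(\sigma,\mu)$, and then: $\mathbf U_S[e]$ if $e$ takes each value in $S$ with probability $1/|S|$; $e\sim e'$ if $[\![e]\!](\sigma,m)=[\![e']\!](\sigma,m)$ for all $m\in\mathrm{supp}(\mu)$; a deterministic atom if it is true in $\sigma$. The connectives $\top,\bot,\wedge,\vee$ are pointwise, and - $w\models\phi\to\psi$ iff for all $w'\sqsupseteq w$, $w'\models\phi$ implies $w'\models\psi$; - $w\models\phi*\psi$ iff there are $w_1\models\phi$, $w_2\models\psi$ with $w_1\circ w_2$ defined and $w_1\circ w_2\sqsubseteq w$; - $w\models\phi-\!\!*\,\psi$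 iff for all $w'\models\phi$ with $w\circ w'$ defined, $w\circ w'\models\psi$. Write $\models\phi$ if $\phi$ holds in all worlds, and $\mathbf D[e]$ for $e\sim e$. A formula $\phi$ is *supported* ($\mathrm{SP}$) if for every $\sigma\in\mathbf{DetM}[\mathcal{DV}]$ such that $(\sigma,\mu')\models\phi$ for some $\mu'$, there is $\mu$ with $(\sigma,\mu)\models\phi$ and $(\sigma,\mu)\sqsubseteq(\sigma,\mu')$ for all $\mu'$ with $(\sigma,\mu')\models\phi$. It is *closed under mixtures* ($\mathrm{CM}$) if, for every $\sigma\in\mathbf{DetM}[\mathcal{DV}]$, $(\sigma,\mu)\models\phi$ and $(\sigma,\mu')\models\phi$ with $\mathrm{dom}(\mu)=\mathrm{dom}(\mu')$ imply $(\sigma,\rho\mu+(1-\rho)\mu')\models\phi$ for all $\rho\in[0,1]$. **Variable sets.** $\mathrm{FV}$ denotes the free variables (of both kinds), $\mathrm{FV}_R$ the free random variables, and $\mathrm{MV}(c)$ the set of all variables (of both kinds) assigned or sampled in $c$. The sets $\mathrm{RV}(c),\mathrm{WV}(c)\subseteq\mathcal{RV}$ are defined by: both are empty for $\mathbf{skip}$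 and $x_d\leftarrow e_d$; $\mathrm{RV}(x_r\leftarrow e)=\mathrm{FV}_R(e)$, $\mathrm{WV}(x_r\leftarrow e)=\{x_r\}\setminus\mathrm{FV}_R(e)$; $\mathrm{RV}(x_r\xleftarrow{\$}\mathbf U_S)=\emptyset$, $\mathrm{WV}(x_r\xleftarrow{\$}\mathbf U_S)=\{x_r\}$; $\mathrm{RV}(c;c')=\mathrm{RV}(c)\cup(\mathrm{RV}(c')\setminus\mathrm{WV}(c))$, $\mathrm{WV}(c;c')=\mathrm{WV}(c)\cup(\mathrm{WV}(c')\setminus\mathrm{RV}(c))$; for a conditional with guard $b$ and branches $c,c'$ (of either sort), $\mathrm{RV}=\mathrm{FV}_R(b)\cup\mathrm{RV}(c)\cup\mathrm{RV}(c')$ and $\mathrm{WV}=(\mathrm{WV}(c)\cap\mathrm{WV}(c'))\setminus\mathrm{FV}_R(b)$; for a loop with body $c$, $\mathrm{RV}=\mathrm{RV}(c)$ and $\mathrm{WV}=\emptyset$. **Proof rules.** Derivability $\vdash\{\phi\}\,c\,\{\psi\}$ is the least relation closed under: - DAssn: $\vdash\{\psi[e_d/x_d]\}\,x_d\leftarrow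 e_d\,\{\psi\}$. Skip: $\vdash\{\phi\}\,\mathbf{skip}\,\{\phi\}$. Seqn: from $\{\phi\}c\{\psi\}$ and $\{\psi\}c'\{\eta\}$ infer $\{\phi\}c;c'\{\eta\}$. - DCond: from $\{\phi\wedge b=\mathit{tt}\}c\{\psi\}$ and $\{\phi\wedge b=\mathit{ff}\}c'\{\psi\}$ infer $\{\phi\}\,\mathbf{if}_D\,b\,\mathbf{then}\,c\,\mathbf{else}\,c'\,\{\psi\}$. DLoop: from $\{\phi\wedge b=\mathit{tt}\}c\{\phi\}$ infer $\{\phi\}\,\mathbf{while}_D\,b\,\mathbf{do}\,c\,\{\phi\wedge b=\mathit{ff}\}$. - RAssn: $\vdash\{\top\}x_r\leftarrow e_r\{x_r\sim e_r\}$ if $x_r\notin\mathrm{FV}(e_r)$. RSamp: $\vdash\{\top\}x_r\xleftarrow{\$}\mathbf U_S\{\mathbf U_S[x_r]\}$. - RDCond: from $\{\phi\wedge b\sim\mathit{tt}\}c\{\psi\}$, $\{\phi\wedge b\sim\mathit{ff}\}c'\{\psi\}$ and $\models\phi\to(b\sim\mathit{tt}\vee b\sim\mathit{ff})$ infer $\{\phi\}\,\mathbf{if}_R\,b\,\mathbf{then}\,c\,\mathbf{else}\,c'\,\{\psi\}$.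 - RCond: from $\{\phi*b\sim\mathit{tt}\}c\{\psi*b\sim\mathit{tt}\}$, $\{\phi*b\sim\mathit{ff}\}c'\{\psi*b\sim\mathit{ff}\}$ and $\psi\in\mathrm{SP}$ infer $\{\phi*\mathbf D[b]\}\,\mathbf{if}_R\,b\,\mathbf{then}\,c\,\mathbf{else}\,c'\,\{\psi*\mathbf D[b]\}$. - RCondCM: from $\{\phi*b\sim\mathit{tt}\}c\{\psi\}$, $\{\phi*b\sim\mathit{ff}\}c'\{\psi\}$ and $\psi\in\mathrm{CM}$ infer $\{\phi*\mathbf D[b]\}\,\mathbf{if}_R\,b\,\mathbf{then}\,c\,\mathbf{else}\,c'\,\{\psi\}$. - Weak: from $\{\phi\}c\{\psi\}$, $\models\phi'\to\phi$ and $\models\psi\to\psi'$ infer $\{\phi'\}c\{\psi'\}$. True: $\vdash\{\top\}c\{\top\}$. Conj, Case: from $\{\phi_i\}c\{\psi_i\}$ ($i=1,2$) infer $\{\phi_1\wedge\phi_2\}c\{\psi_1\wedge\psi_2\}$, respectively $\{\phi_1\vee\phi_2\}c\{\psi_1\vee\psi_2\}$. - RCase: from $\{\phi*b\sim\mathit{tt}\}c\{\psi*b\sim\mathit{tt}\}$,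 $\{\phi*b\sim\mathit{ff}\}c\{\psi*b\sim\mathit{ff}\}$ and $\psi\in\mathrm{SP}$ infer $\{\phi*\mathbf D[b]\}c\{\psi*\mathbf D[b]\}$. - Const: from $\{\phi\}c\{\psi\}$ and $\mathrm{FV}(\eta)\cap\mathrm{MV}(c)=\emptyset$ infer $\{\phi\wedge\eta\}c\{\psi\wedge\eta\}$. - Frame: for any $T\subseteq\mathcal{RV}$, from $\{\phi\}c\{\psi\}$, $\mathrm{FV}(\eta)\cap\mathrm{MV}(c)=\emptyset$, $\mathrm{FV}_R(\psi)\subseteq T\cup\mathrm{RV}(c)\cup\mathrm{WV}(c)$ and $\models\phi\to\mathbf D[x]$ for every $x\in T\cup\mathrm{RV}(c)$, infer $\{\phi*\eta\}c\{\psi*\eta\}$. **Theorem (Soundness).** Let $c$ be a command that terminates on all inputs. If $\vdash\{\phi\}\,c\,\{\psi\}$ is derivable, then it is valid: for every full configuration $(\sigma,\mu)$ with $(\sigma,\mu)\models\phi$, the output $[\![c]\!](\sigma,\mu)$ is defined and satisfies $\psi$. -/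

import Mathlib

open scoped ENNReal

/-- The parameters of the programming language: types (with a type of booleans), values,
operators of the expression language with their interpretation (the base theory), predicates on
deterministic expressions with their interpretation (equality is built in below), and the
deterministic and random variables, each with its type.  Every expression is well typed by
construction and every memory assigns to a variable a value of its type. -/
structure Sig where
  Ty : Type
  bool : Ty
  Val : Ty → Type
  boolEquiv : Val bool ≃ Bool
  Op : {n : ℕ} → (Fin n → Ty) → Ty → Type
  evalOp : {n : ℕ} → {as : Fin n → Ty} → {t : Ty} → Op as t → (∀ i, Val (as i)) → Val t
  Pred : {n : ℕ} → (Fin n → Ty) → Type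
  evalPred : {n : ℕ} → {as : Fin n → Ty} → Pred as → (∀ i, Val (as i)) → Prop
  DV : Type
  RV : Type
  dty : DV → Ty
  rty : RV → Ty
  countable_Val : ∀ t, Countable (Val t)
  countable_DV : Countable DV
  countable_RV : Countable RV

namespace PSL

variable {L : Sig}

/-! ### Memories -/

/-- All program variables: the disjoint union of deterministic and random variables. -/
abbrev Var (L : Sig) : Type := L.DV ⊕ L.RV

/-- The values of a deterministic variable. -/
abbrev DVal (L : Sig) (x : L.DV) : Type := L.Val (L.dty x)

/-- The values of a random variable. -/
abbrev RVal (L : Sig) (x : L.RV) : Type := L.Val (L.rty x)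

/-- Deterministic memories with domain `S`. -/
abbrev DetM (L : Sig) (S : Set L.DV) : Type := ∀ x : S, DVal L x

/-- Random memories with domain `T`. -/
abbrev RanM (L : Sig) (T : Set L.RV) : Type := ∀ x : T, RVal L x

/-- The variables covered by a pair of domains. -/
def domain (S : Set L.DV) (T : Set L.RV) : Set (Var L) :=
  {v | Sum.elim (fun x => x ∈ S) (fun x => x ∈ T) v}

section Mem

variable {V : Type} (F : V → Type)

/-- Restriction of a memory to a smaller domain. -/
def restr {S S' : Set V} (h : S ⊆ S') (m : ∀ x : S', F x) : ∀ x : S, F x :=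
  fun x => m ⟨x, h x.2⟩

open Classical in
/-- Union of two memories (which is only used when they agree on the common domain). -/
noncomputable def glue {S S' : Set V} (m : ∀ x : S, F x) (m' : ∀ x : S', F x) :
    ∀ x : (S ∪ S' : Set V), F x :=
  fun x => if h : (x : V) ∈ S then m ⟨x, h⟩ else m' ⟨x, x.2.resolve_left h⟩

/-- Two memories agree on their common domain. -/
def Agree {S S' : Set V} (m : ∀ x : S, F x) (m' : ∀ x : S', F x) : Prop :=
  ∀ (x : V) (h : x ∈ S) (h' : x ∈ S'), m ⟨x, h⟩ = m' ⟨x, h'⟩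

open Classical in
/-- The update `m[x ↦ v]` of a memory defined on all variables. -/
noncomputable def upd (m : ∀ x : (Set.univ : Set V), F x) (x : V) (v : F x) :
    ∀ x : (Set.univ : Set V), F x :=
  Function.update m ⟨x, trivial⟩ v

end Mem

/-- The independent product of distributions over memories (used for disjoint `T`, `T'`):
for `m` with domain `T ∪ T'` its value is `μ(m restricted to T) * μ'(m restricted to T')`. -/
noncomputable def prodDist {T T' : Set L.RV} (μ : PMF (RanM L T)) (μ' : PMF (RanM L T')) :
    PMF (RanM L (T ∪ T')) :=
  μ.bind fun m => μ'.map fun m' => glue (RVal L) m m'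

/-- The convex combination `ρ μ₁ + (1 - ρ) μ₂`. -/
noncomputable def convComb {A : Type} (ρ : ℝ≥0∞) (hρ : ρ ≤ 1) (μ₁ μ₂ : PMF A) : PMF A :=
  ⟨fun a => ρ * μ₁ a + (1 - ρ) * μ₂ a, by
    refine (Summable.hasSum_iff ENNReal.summable).2 ?_
    rw [ENNReal.tsum_add, ENNReal.tsum_mul_left, ENNReal.tsum_mul_left, μ₁.tsum_coe,
      μ₂.tsum_coe, mul_one, mul_one, add_tsub_cancel_of_le hρ]⟩

/-! ### Expressions -/

/-- Deterministic expressions. -/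
inductive DExp (L : Sig) : L.Ty → Type
  | var (x : L.DV) : DExp L (L.dty x)
  | lit (b : Bool) : DExp L L.bool
  | op {n : ℕ} {as : Fin n → L.Ty} {t : L.Ty} (f : L.Op as t)
      (args : ∀ i, DExp L (as i)) : DExp L t

/-- Randomized expressions. -/
inductive RExp (L : Sig) : L.Ty → Type
  | det {t : L.Ty} (e : DExp L t) : RExp L t
  | var (x : L.RV) : RExp L (L.rty x)
  | op {n : ℕ} {as : Fin n → L.Ty} {t : L.Ty} (f : L.Op as t)
      (args : ∀ i, RExp L (as i)) : RExp L t

/-- Free variables of a deterministic expression. -/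
def DExp.fv : {t : L.Ty} → DExp L t → Set (Var L)
  | _, .var x => {Sum.inl x}
  | _, .lit _ => ∅
  | _, .op _ args => ⋃ i, (args i).fv

/-- Free variables of a randomized expression. -/
def RExp.fv : {t : L.Ty} → RExp L t → Set (Var L)
  | _, .det e => e.fv
  | _, .var x => {Sum.inr x}
  | _, .op _ args => ⋃ i, (args i).fv

/-- The value of a deterministic expression in a memory whose domain contains its variables. -/
def DExp.eval {S : Set L.DV} {T : Set L.RV} (σ : DetM L S) :
    {t : L.Ty} → (e : DExp L t) → e.fv ⊆ domain S T → L.Val t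
  | _, .var x, h => σ ⟨x, h rfl⟩
  | _, .lit b, _ => L.boolEquiv.symm b
  | _, .op f args, h =>
      L.evalOp f fun i => (args i).eval σ ((Set.subset_iUnion _ i).trans h)

/-- The value of a randomized expression in memories whose domains contain its variables. -/
def RExp.eval {S : Set L.DV} {T : Set L.RV} (σ : DetM L S) (m : RanM L T) :
    {t : L.Ty} → (e : RExp L t) → e.fv ⊆ domain S T → L.Val t
  | _, .det e, h => e.eval σ h
  | _, .var x, h => m ⟨x, h rfl⟩
  | _, .op f args, h =>
      L.evalOp f fun i => (args i).eval σ m ((Set.subset_iUnion _ i).trans h)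

theorem subset_domain_univ (A : Set (Var L)) :
    A ⊆ domain (Set.univ : Set L.DV) (Set.univ : Set L.RV) := by
  rintro (x | x) _ <;> trivial

open Classical in
/-- Substitution `e[d/x]` of a deterministic expression for a deterministic variable. -/
noncomputable def DExp.subst (x : L.DV) (d : DExp L (L.dty x)) :
    {t : L.Ty} → DExp L t → DExp L t
  | _, .var y => if h : x = y then h ▸ d else .var y
  | _, .lit b => .lit b
  | _, .op f args => .op f fun i => DExp.subst x d (args i)

/-- Substitution `e[d/x]` in a randomized expression. -/
noncomputable def RExp.subst (x : L.DV) (d : DExp L (L.dty x)) :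
    {t : L.Ty} → RExp L t → RExp L t
  | _, .det e => .det (DExp.subst x d e)
  | _, .var y => .var y
  | _, .op f args => .op f fun i => RExp.subst x d (args i)

/-! ### Commands -/

/-- `Kind.rand` marks the commands that may stand under a random guard (they cannot assign to
deterministic variables), `Kind.gen` the general commands. -/
inductive Kind
  | gen
  | rand

/-- Commands: `Cmd L .rand` and `Cmd L .gen` are the two syntactic classes of commands. -/
inductive Cmd (L : Sig) : Kind → Type
  | skip {k : Kind} : Cmd L k
  | dassn (x : L.DV) (e : DExp L (L.dty x)) : Cmd L .gen
  | rassn {k : Kind} (x : L.RV) (e : RExp L (L.rty x)) : Cmd L k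
  | samp {k : Kind} (x : L.RV) (S : Finset (L.Val (L.rty x))) (hS : S.Nonempty) : Cmd L k
  | seq {k : Kind} (c c' : Cmd L k) : Cmd L k
  | dcond {k : Kind} (b : DExp L L.bool) (c c' : Cmd L k) : Cmd L k
  | rcond {k : Kind} (b : RExp L L.bool) (c c' : Cmd L .rand) : Cmd L k
  | dwhile {k : Kind} (b : DExp L L.bool) (c : Cmd L k) : Cmd L k

/-- Full configurations: a deterministic memory and a distribution over random memories, both
defined on all variables. -/
abbrev Config (L : Sig) : Type := DetM L Set.univ × PMF (RanM L Set.univ)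

/-- The truth value of a deterministic guard. -/
def DExp.test (b : DExp L L.bool) (σ : DetM L Set.univ) : Bool :=
  L.boolEquiv (b.eval σ (subset_domain_univ _))

/-- The event that a random guard is true. -/
def RExp.event (b : RExp L L.bool) (σ : DetM L Set.univ) : Set (RanM L Set.univ) :=
  {m | L.boolEquiv (b.eval σ m (subset_domain_univ _)) = true}

theorem exists_mem_compl_support {A : Type} (μ : PMF A) {B : Set A}
    (h : ¬ ∃ a ∈ B, a ∈ μ.support) : ∃ a ∈ Bᶜ, a ∈ μ.support := by
  obtain ⟨a, ha⟩ := μ.support_nonempty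
  exact ⟨a, fun hB => h ⟨a, hB, ha⟩, ha⟩

theorem toOuterMeasure_le_one {A : Type} (μ : PMF A) (B : Set A) : μ.toOuterMeasure B ≤ 1 := by
  rw [μ.toOuterMeasure_apply, ← μ.tsum_coe]
  exact ENNReal.tsum_le_tsum fun a => Set.indicator_le_self' (fun _ _ => bot_le) a

open Classical in
/-- The semantics of commands; the value is undefined exactly when the program does not
terminate.  A random conditional conditions the input distribution on the guard being true and
being false, runs the branches and takes the convex combination of the outputs with weight
`ρ = μ(b = tt)`; if `ρ = 1` or `ρ = 0` it is just the one branch.  Both branches leave the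
deterministic memory unchanged, so their output memories coincide. -/
noncomputable def Cmd.sem : {k : Kind} → Cmd L k → Config L → Part (Config L)
  | _, .skip => fun s => Part.some s
  | _, .dassn x e => fun s => Part.some (upd (DVal L) s.1 x (e.eval s.1 (subset_domain_univ _)), s.2)
  | _, .rassn x e => fun s =>
      Part.some (s.1, s.2.bind fun m =>
        PMF.pure (upd (RVal L) m x (e.eval s.1 m (subset_domain_univ _))))
  | _, .samp x S hS => fun s =>
      Part.some (s.1, s.2.bind fun m =>
        (PMF.uniformOfFinset S hS).bind fun u => PMF.pure (upd (RVal L) m x u))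
  | _, .seq c c' => fun s => (c.sem s).bind c'.sem
  | _, .dcond b c c' => fun s => if b.test s.1 = true then c.sem s else c'.sem s
  | _, .rcond b c c' => fun s =>
      if ht : ∃ m ∈ b.event s.1, m ∈ s.2.support then
        if hf : ∃ m ∈ (b.event s.1)ᶜ, m ∈ s.2.support then
          (c.sem (s.1, s.2.filter (b.event s.1) ht)).bind fun s₁ =>
            (c'.sem (s.1, s.2.filter (b.event s.1)ᶜ hf)).map fun s₂ =>
              (s₁.1, convComb (s.2.toOuterMeasure (b.event s.1))
                (toOuterMeasure_le_one _ _) s₁.2 s₂.2)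
        else c.sem (s.1, s.2.filter (b.event s.1) ht)
      else c'.sem (s.1, s.2.filter (b.event s.1)ᶜ (exists_mem_compl_support _ ht))
  | _, .dwhile b c => fun s =>
      PFun.fix (fun s : Config L =>
        if b.test s.1 = true then (c.sem s).map Sum.inr else Part.some (Sum.inl s)) s

/-- The program terminates on all inputs. -/
def Cmd.Terminates {k : Kind} (c : Cmd L k) : Prop := ∀ s : Config L, (c.sem s).Dom

/-- The random variables among a set of variables. -/
def randomVars (A : Set (Var L)) : Set L.RV := {x | Sum.inr x ∈ A}

/-- The random variables that a command may read (`.1`), and those that it must write before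
possibly reading them (`.2`), computed together by recursion. -/
def Cmd.rw : {k : Kind} → Cmd L k → Set L.RV × Set L.RV
  | _, .skip => (∅, ∅)
  | _, .dassn _ _ => (∅, ∅)
  | _, .rassn x e => (randomVars e.fv, {x} \ randomVars e.fv)
  | _, .samp x _ _ => (∅, {x})
  | _, .seq c c' => (c.rw.1 ∪ (c'.rw.1 \ c.rw.2), c.rw.2 ∪ (c'.rw.2 \ c.rw.1))
  | _, .dcond _ c c' => (c.rw.1 ∪ c'.rw.1, c.rw.2 ∩ c'.rw.2)
  | _, .rcond b c c' =>
      (randomVars b.fv ∪ c.rw.1 ∪ c'.rw.1, (c.rw.2 ∩ c'.rw.2) \ randomVars b.fv)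
  | _, .dwhile _ c => (c.rw.1, ∅)

/-- Read variables. -/
def Cmd.readVars {k : Kind} (c : Cmd L k) : Set L.RV := c.rw.1

/-- Must-write variables. -/
def Cmd.writeVars {k : Kind} (c : Cmd L k) : Set L.RV := c.rw.2

/-- Variables, deterministic or random, that a command may modify. -/
def Cmd.modVars : {k : Kind} → Cmd L k → Set (Var L)
  | _, .skip => ∅
  | _, .dassn x _ => {Sum.inl x}
  | _, .rassn x _ => {Sum.inr x}
  | _, .samp x _ _ => {Sum.inr x}
  | _, .seq c c' => c.modVars ∪ c'.modVars
  | _, .dcond _ c c' => c.modVars ∪ c'.modVars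
  | _, .rcond _ c c' => c.modVars ∪ c'.modVars
  | _, .dwhile _ c => c.modVars

/-! ### The probabilistic model of the logic of bunched implications -/

/-- Worlds: a deterministic memory and a distribution over random memories, with arbitrary
domains. -/
structure World (L : Sig) where
  S : Set L.DV
  T : Set L.RV
  σ : DetM L S
  μ : PMF (RanM L T)

/-- The set of variables in the domain of a world. -/
def World.dom (w : World L) : Set (Var L) := domain w.S w.T

/-- A full configuration as a world. -/
def Config.toWorld (s : Config L) : World L := ⟨Set.univ, Set.univ, s.1, s.2⟩

/-- The order on worlds: `w'` extends `w`. -/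
def World.le (w w' : World L) : Prop :=
  ∃ (hS : w.S ⊆ w'.S) (hT : w.T ⊆ w'.T),
    w.σ = restr (DVal L) hS w'.σ ∧ w.μ = w'.μ.map (restr (RVal L) hT)

/-- The partial product `w ∘ w'` is defined. -/
def World.Compat (w w' : World L) : Prop := Agree (DVal L) w.σ w'.σ ∧ Disjoint w.T w'.T

/-- The product `w ∘ w'` (only used when `w.Compat w'`). -/
noncomputable def World.comb (w w' : World L) : World L :=
  ⟨w.S ∪ w'.S, w.T ∪ w'.T, glue (DVal L) w.σ w'.σ, prodDist w.μ w'.μ⟩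

/-- Formulas.  Atoms: `unif S e` is "`e` is uniform on `S`", `eqv e e'` is `e ∼ e'`, `deq` is
equality of deterministic expressions, and `dpred` applies a predicate of the base theory
(such as `≤`) to deterministic expressions. -/
inductive Form (L : Sig) : Type
  | unif {t : L.Ty} (S : Finset (L.Val t)) (hS : S.Nonempty) (e : RExp L t)
  | eqv {t : L.Ty} (e e' : RExp L t)
  | deq {t : L.Ty} (e e' : DExp L t)
  | dpred {n : ℕ} {as : Fin n → L.Ty} (p : L.Pred as) (args : ∀ i, DExp L (as i))
  | top
  | bot
  | and (φ ψ : Form L)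
  | or (φ ψ : Form L)
  | imp (φ ψ : Form L)
  | sep (φ ψ : Form L)
  | wand (φ ψ : Form L)

/-- Satisfaction `w ⊨ φ`. -/
def Sat : World L → Form L → Prop
  | w, .unif S _ e => ∃ h : e.fv ⊆ w.dom,
      ∀ v ∈ S, (w.μ.map fun m => e.eval w.σ m h) v = (S.card : ℝ≥0∞)⁻¹
  | w, .eqv e e' => ∃ (h : e.fv ⊆ w.dom) (h' : e'.fv ⊆ w.dom),
      ∀ m ∈ w.μ.support, e.eval w.σ m h = e'.eval w.σ m h'
  | w, .deq e e' => ∃ (h : e.fv ⊆ w.dom) (h' : e'.fv ⊆ w.dom), e.eval w.σ h = e'.eval w.σ h'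
  | w, .dpred p args => ∃ h : ∀ i, (args i).fv ⊆ w.dom,
      L.evalPred p fun i => (args i).eval w.σ (h i)
  | _, .top => True
  | _, .bot => False
  | w, .and φ ψ => Sat w φ ∧ Sat w ψ
  | w, .or φ ψ => Sat w φ ∨ Sat w ψ
  | w, .imp φ ψ => ∀ w', w.le w' → Sat w' φ → Sat w' ψ
  | w, .sep φ ψ => ∃ w₁ w₂, w₁.Compat w₂ ∧ (w₁.comb w₂).le w ∧ Sat w₁ φ ∧ Sat w₂ ψ
  | w, .wand φ ψ => ∀ w', Sat w' φ → w.Compat w' → Sat (w.comb w') ψ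

/-- Validity of a formula: it holds in all worlds. -/
def Form.Valid (φ : Form L) : Prop := ∀ w : World L, Sat w φ

/-- Free variables of a formula. -/
def Form.fv : Form L → Set (Var L)
  | .unif _ _ e => e.fv
  | .eqv e e' => e.fv ∪ e'.fv
  | .deq e e' => e.fv ∪ e'.fv
  | .dpred _ args => ⋃ i, (args i).fv
  | .top => ∅
  | .bot => ∅
  | .and φ ψ => φ.fv ∪ ψ.fv
  | .or φ ψ => φ.fv ∪ ψ.fv
  | .imp φ ψ => φ.fv ∪ ψ.fv
  | .sep φ ψ => φ.fv ∪ ψ.fv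
  | .wand φ ψ => φ.fv ∪ ψ.fv

/-- Substitution `φ[d/x]` for a deterministic variable. -/
noncomputable def Form.subst (x : L.DV) (d : DExp L (L.dty x)) : Form L → Form L
  | .unif S hS e => .unif S hS (RExp.subst x d e)
  | .eqv e e' => .eqv (RExp.subst x d e) (RExp.subst x d e')
  | .deq e e' => .deq (DExp.subst x d e) (DExp.subst x d e')
  | .dpred p args => .dpred p fun i => DExp.subst x d (args i)
  | .top => .top
  | .bot => .bot
  | .and φ ψ => .and (Form.subst x d φ) (Form.subst x d ψ)
  | .or φ ψ => .or (Form.subst x d φ) (Form.subst x d ψ)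
  | .imp φ ψ => .imp (Form.subst x d φ) (Form.subst x d ψ)
  | .sep φ ψ => .sep (Form.subst x d φ) (Form.subst x d ψ)
  | .wand φ ψ => .wand (Form.subst x d φ) (Form.subst x d ψ)

/-- `D[e]`, that is `e ∼ e`: the variables of `e` are in the domain. -/
def Form.defd {t : L.Ty} (e : RExp L t) : Form L := .eqv e e

/-- `b ∼ v` for a truth value `v`. -/
def Form.ris (b : RExp L L.bool) (v : Bool) : Form L := .eqv b (.det (.lit v))

/-- `b = v` for a truth value `v`. -/
def Form.dis (b : DExp L L.bool) (v : Bool) : Form L := .deq b (.lit v)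

/-- Supported formulas: for every deterministic memory `σ`, if `φ` is satisfiable over `σ`, the
distributions satisfying `φ` over `σ` have a least element. -/
def Form.Supported (φ : Form L) : Prop :=
  ∀ σ : DetM L Set.univ, ∃ (T : Set L.RV) (μ : PMF (RanM L T)),
    ∀ (T' : Set L.RV) (μ' : PMF (RanM L T')), Sat ⟨Set.univ, T', σ, μ'⟩ φ →
      Sat ⟨Set.univ, T, σ, μ⟩ φ ∧ ∃ hT : T ⊆ T', μ = μ'.map (restr (RVal L) hT)

/-- Formulas closed under mixtures. -/
def Form.ClosedUnderMixtures (φ : Form L) : Prop :=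
  ∀ (σ : DetM L Set.univ) (T : Set L.RV) (μ μ' : PMF (RanM L T)) (ρ : ℝ≥0∞) (hρ : ρ ≤ 1),
    Sat ⟨Set.univ, T, σ, μ⟩ φ → Sat ⟨Set.univ, T, σ, μ'⟩ φ →
      Sat ⟨Set.univ, T, σ, convComb ρ hρ μ μ'⟩ φ

/-! ### The program logic -/

/-- Validity of the judgment `{φ} c {ψ}`: from every full configuration satisfying `φ` the
program produces an output, and this output satisfies `ψ`. -/
def Valid {k : Kind} (φ : Form L) (c : Cmd L k) (ψ : Form L) : Prop :=
  ∀ s : Config L, Sat (Config.toWorld s) φ → ∃ s' ∈ c.sem s, Sat (Config.toWorld s') ψ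

/-- Derivability of the judgment `{φ} c {ψ}` with the proof rules. -/
inductive Derivable : {k : Kind} → Form L → Cmd L k → Form L → Prop
  | dassn (ψ : Form L) (x : L.DV) (e : DExp L (L.dty x)) :
      Derivable (Form.subst x e ψ) (.dassn x e) ψ
  | skip {k : Kind} (φ : Form L) : Derivable φ (.skip : Cmd L k) φ
  | seqn {k : Kind} {φ ψ η : Form L} {c c' : Cmd L k} :
      Derivable φ c ψ → Derivable ψ c' η → Derivable φ (.seq c c') η
  | dcond {k : Kind} {φ ψ : Form L} {b : DExp L L.bool} {c c' : Cmd L k} :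
      Derivable (.and φ (.dis b true)) c ψ → Derivable (.and φ (.dis b false)) c' ψ →
      Derivable φ (.dcond b c c') ψ
  | dloop {k : Kind} {φ : Form L} {b : DExp L L.bool} {c : Cmd L k} :
      Derivable (.and φ (.dis b true)) c φ →
      Derivable φ (.dwhile b c) (.and φ (.dis b false))
  | rassn {k : Kind} (x : L.RV) (e : RExp L (L.rty x)) : Sum.inr x ∉ e.fv →
      Derivable .top (.rassn x e : Cmd L k) (.eqv (.var x) e)
  | rsamp {k : Kind} (x : L.RV) (S : Finset (L.Val (L.rty x))) (hS : S.Nonempty) :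
      Derivable .top (.samp x S hS : Cmd L k) (.unif S hS (.var x))
  | rdcond {k : Kind} {φ ψ : Form L} {b : RExp L L.bool} {c c' : Cmd L .rand} :
      Derivable (.and φ (.ris b true)) c ψ → Derivable (.and φ (.ris b false)) c' ψ →
      (Form.imp φ (.or (.ris b true) (.ris b false))).Valid →
      Derivable φ (.rcond b c c' : Cmd L k) ψ
  | rcond {k : Kind} {φ ψ : Form L} {b : RExp L L.bool} {c c' : Cmd L .rand} :
      Derivable (.sep φ (.ris b true)) c (.sep ψ (.ris b true)) →
      Derivable (.sep φ (.ris b false)) c' (.sep ψ (.ris b false)) →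
      ψ.Supported →
      Derivable (.sep φ (.defd b)) (.rcond b c c' : Cmd L k) (.sep ψ (.defd b))
  | rcondCM {k : Kind} {φ ψ : Form L} {b : RExp L L.bool} {c c' : Cmd L .rand} :
      Derivable (.sep φ (.ris b true)) c ψ → Derivable (.sep φ (.ris b false)) c' ψ →
      ψ.ClosedUnderMixtures →
      Derivable (.sep φ (.defd b)) (.rcond b c c' : Cmd L k) ψ
  | weak {k : Kind} {φ ψ φ' ψ' : Form L} {c : Cmd L k} :
      Derivable φ c ψ → (Form.and (.imp φ' φ) (.imp ψ ψ')).Valid → Derivable φ' c ψ'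
  | true {k : Kind} (c : Cmd L k) : Derivable .top c .top
  | conj {k : Kind} {φ₁ φ₂ ψ₁ ψ₂ : Form L} {c : Cmd L k} :
      Derivable φ₁ c ψ₁ → Derivable φ₂ c ψ₂ → Derivable (.and φ₁ φ₂) c (.and ψ₁ ψ₂)
  | case {k : Kind} {φ₁ φ₂ ψ₁ ψ₂ : Form L} {c : Cmd L k} :
      Derivable φ₁ c ψ₁ → Derivable φ₂ c ψ₂ → Derivable (.or φ₁ φ₂) c (.or ψ₁ ψ₂)
  | rcase {k : Kind} {φ ψ : Form L} {b : RExp L L.bool} {c : Cmd L k} :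
      Derivable (.sep φ (.ris b true)) c (.sep ψ (.ris b true)) →
      Derivable (.sep φ (.ris b false)) c (.sep ψ (.ris b false)) →
      ψ.Supported →
      Derivable (.sep φ (.defd b)) c (.sep ψ (.defd b))
  | const {k : Kind} {φ ψ η : Form L} {c : Cmd L k} :
      Derivable φ c ψ → Disjoint η.fv c.modVars → Derivable (.and φ η) c (.and ψ η)
  | frame {k : Kind} {φ ψ η : Form L} {c : Cmd L k} (T : Set L.RV) :
      Derivable φ c ψ → Disjoint η.fv c.modVars →
      randomVars ψ.fv ⊆ T ∪ c.readVars ∪ c.writeVars →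
      (∀ x ∈ T ∪ c.readVars, (Form.imp φ (.defd (.var x))).Valid) →
      Derivable (.sep φ η) c (.sep ψ η)

end PSL

/-!
The proof goes by induction on derivations. The induction establishes partial correctness
(`PartialValid`), since a subprogram of a terminating program need not terminate on all inputs;
termination is used only once, for the program itself.

*Formulas.* Satisfaction is monotone in the world (`sat_mono`). Over a total deterministic memory
this removes all reference to partial deterministic memories: `*` says that two disjoint sets of
random variables are independent and have marginals satisfying the two formulas (`sat_full_sep`),
and the two implications quantify over distributions only (`sat_full_imp`, `sat_full_wand`).
Satisfaction depends on the free variables only (`sat_congr_det`, `sat_marg`). The interesting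
case is the implication: an extension of a marginal of `μ` has to be turned into an extension of
`μ` itself, which is possible because two discrete distributions that agree on their common
variables can be amalgamated (`exists_amalgam`).

*Programs.* The deterministic memory of a run never depends on the random one, and over a fixed
deterministic memory a program is a Markov kernel (`kernelAt_sem`): the output from `μ` is the
mixture of the outputs from the points of its support. The law of the output on the written
variables depends only on the law of the input on the read variables (`sameOn_sem`), and variables
that are not modified keep their values (`sem_unmodified`).

*Rules.* In the rules for random conditionals and for case distinction the guard is independent of
`φ`, so conditioning on it preserves `φ`. The two outputs are then mixed; if `ψ` is supported, both
have the same least model of `ψ` as a marginal, independent of the guard, and so does the mixture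
(`Form.Supported.sat_convComb`). In the frame rule the output on the variables of `ψ` is computed
by a kernel from the part of the memory described by `φ`, while the variables of `η` are copied, so
the independence of the inputs carries over to the outputs (`Indep.bind`).
-/

namespace PSL

variable {L : Sig}

/-! ### Discrete distributions -/

section Distributions

variable {A B C D : Type}

theorem bind_congr_support (p : PMF A) {f g : A → PMF B} (h : ∀ a ∈ p.support, f a = g a) :
    p.bind f = p.bind g := by
  ext b
  simp only [PMF.bind_apply]
  refine tsum_congr fun a => ?_
  by_cases ha : a ∈ p.support
  · rw [h a ha]
  · rw [PMF.mem_support_iff, not_not] at ha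
    simp [ha]

theorem map_congr_support (p : PMF A) {f g : A → B} (h : ∀ a ∈ p.support, f a = g a) :
    p.map f = p.map g :=
  bind_congr_support p fun a ha => by simp [h a ha]

theorem support_pure_unique {a b : A} (h : b ∈ (PMF.pure a).support) : b = a := by
  simpa using h

/-- Two distributions with densities proportional to the same function are equal. -/
theorem eq_of_proportional {p q : PMF A} {r : A → ℝ≥0∞} {c c' : ℝ≥0∞}
    (hp : ∀ a, p a = c * r a) (hq : ∀ a, q a = c' * r a) : p = q := by
  have h1 : c * ∑' a, r a = 1 := by
    rw [← ENNReal.tsum_mul_left, ← p.tsum_coe]; exact tsum_congr fun a => (hp a).symm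
  have h2 : c' * ∑' a, r a = 1 := by
    rw [← ENNReal.tsum_mul_left, ← q.tsum_coe]; exact tsum_congr fun a => (hq a).symm
  have : c = c' := by
    rw [ENNReal.eq_inv_of_mul_eq_one_left h1, ENNReal.eq_inv_of_mul_eq_one_left h2]
  ext a
  rw [hp, hq, this]

theorem filter_apply_comm (p : PMF A) (s : Set A) (h : ∃ a ∈ s, a ∈ p.support) (a : A) :
    p.filter s h a = (∑' x, s.indicator p x)⁻¹ * s.indicator p a := by
  rw [PMF.filter_apply, mul_comm]

theorem filter_eq_self (p : PMF A) (s : Set A) (h : ∃ a ∈ s, a ∈ p.support)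
    (hs : ∀ a ∈ p.support, a ∈ s) : p.filter s h = p := by
  refine eq_of_proportional (r := s.indicator p) (c' := 1) (filter_apply_comm p s h) fun a => ?_
  by_cases ha : a ∈ p.support
  · simp [hs a ha]
  · rw [PMF.mem_support_iff, not_not] at ha
    rw [one_mul, ha, eq_comm, Set.indicator_apply_eq_zero]
    exact fun _ => ha

theorem map_filter_preimage (p : PMF A) (f : A → B) (s : Set A) (t : Set B)
    (hst : ∀ a, a ∈ s ↔ f a ∈ t) (h : ∃ a ∈ s, a ∈ p.support)
    (h' : ∃ b ∈ t, b ∈ (p.map f).support) :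
    (p.filter s h).map f = (p.map f).filter t h' := by
  classical
  refine eq_of_proportional (r := t.indicator (p.map f)) (c := (∑' x, s.indicator p x)⁻¹)
    (fun b => ?_) (filter_apply_comm _ t h')
  rw [PMF.map_apply, Set.indicator_apply]
  split_ifs with hb
  · rw [PMF.map_apply, ← ENNReal.tsum_mul_left]
    refine tsum_congr fun a => ?_
    by_cases hab : b = f a
    · have : a ∈ s := (hst a).2 (hab ▸ hb)
      rw [if_pos hab, if_pos hab, filter_apply_comm, Set.indicator_of_mem this]
    · rw [if_neg hab, if_neg hab, mul_zero]
  · rw [mul_zero, ENNReal.tsum_eq_zero]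
    intro a
    split_ifs with hab
    · exact PMF.filter_apply_eq_zero_of_notMem _ fun ha => hb (hab ▸ (hst a).1 ha)
    · rfl

theorem convComb_apply (ρ : ℝ≥0∞) (hρ : ρ ≤ 1) (p q : PMF A) (a : A) :
    convComb ρ hρ p q a = ρ * p a + (1 - ρ) * q a := rfl

theorem convComb_bind (ρ : ℝ≥0∞) (hρ : ρ ≤ 1) (p q : PMF A) (f : A → PMF B) :
    (convComb ρ hρ p q).bind f = convComb ρ hρ (p.bind f) (q.bind f) := by
  ext b
  simp only [PMF.bind_apply, convComb_apply]
  rw [← ENNReal.tsum_mul_left, ← ENNReal.tsum_mul_left, ← ENNReal.tsum_add]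
  exact tsum_congr fun a => by ring

theorem convComb_map (ρ : ℝ≥0∞) (hρ : ρ ≤ 1) (p q : PMF A) (f : A → B) :
    (convComb ρ hρ p q).map f = convComb ρ hρ (p.map f) (q.map f) :=
  convComb_bind ρ hρ p q _

/-- A distribution is the mixture of its conditionings on an event and on the complement. -/
theorem convComb_filter (p : PMF A) (s : Set A) (h : ∃ a ∈ s, a ∈ p.support)
    (h' : ∃ a ∈ sᶜ, a ∈ p.support) :
    convComb (p.toOuterMeasure s) (toOuterMeasure_le_one p s) (p.filter s h) (p.filter sᶜ h') =
      p := by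
  have key : ∀ (t : Set A) (ht : ∃ a ∈ t, a ∈ p.support) (a : A),
      p.toOuterMeasure t * p.filter t ht a = t.indicator p a := by
    intro t ht a
    rw [filter_apply_comm, p.toOuterMeasure_apply, ← mul_assoc, ENNReal.mul_inv_cancel, one_mul]
    · obtain ⟨b, hb, hbp⟩ := ht
      intro h0
      have := ENNReal.tsum_eq_zero.1 h0 b
      rw [Set.indicator_of_mem hb] at this
      exact (p.mem_support_iff b).1 hbp this
    · exact p.tsum_coe_indicator_ne_top t
  have hc : 1 - p.toOuterMeasure s = p.toOuterMeasure sᶜ := by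
    refine (ENNReal.eq_sub_of_add_eq ?_ ?_).symm
    · rw [p.toOuterMeasure_apply]; exact p.tsum_coe_indicator_ne_top s
    · rw [p.toOuterMeasure_apply, p.toOuterMeasure_apply, ← ENNReal.tsum_add, ← p.tsum_coe]
      refine tsum_congr fun a => ?_
      rw [add_comm]
      exact congrFun (Set.indicator_self_add_compl s p) a
  ext a
  rw [convComb_apply, hc, key, key]
  exact congrFun (Set.indicator_self_add_compl s p) a

/-- A kernel that factors through `f` on the support of `p` factors through `f` by a total
function. -/
theorem exists_factor {β : Type} (p : PMF A) (f : A → B) (h : A → β)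
    (hf : ∀ a ∈ p.support, ∀ a' ∈ p.support, f a = f a' → h a = h a') :
    ∃ g : B → β, ∀ a ∈ p.support, h a = g (f a) := by
  classical
  obtain ⟨a₀, ha₀⟩ := p.support_nonempty
  refine ⟨fun b => if hb : ∃ a ∈ p.support, f a = b then h hb.choose else h a₀, fun a ha => ?_⟩
  have hb : ∃ a' ∈ p.support, f a' = f a := ⟨a, ha, rfl⟩
  refine Eq.trans ?_ (dif_pos hb).symm
  exact hf _ ha _ hb.choose_spec.1 hb.choose_spec.2.symm

/-- If `p` and `q` have the same image under `f`, and two kernels yield the same image under `g`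
from inputs with the same `f`-value, then their outputs have the same image under `g`. -/
theorem map_bind_eq_of_map_eq (p q : PMF A) (f : A → B) (κ κ' : A → PMF C) (g : C → D)
    (hpq : p.map f = q.map f)
    (h : ∀ a ∈ p.support, ∀ a' ∈ q.support, f a = f a' → (κ a).map g = (κ' a').map g) :
    (p.bind κ).map g = (q.bind κ').map g := by
  have hpre : ∀ a ∈ p.support, ∃ a' ∈ q.support, f a' = f a := fun a ha => by
    have : f a ∈ (q.map f).support := hpq ▸ (PMF.mem_support_map_iff _ _ _).2 ⟨a, ha, rfl⟩
    exact (PMF.mem_support_map_iff _ _ _).1 this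
  have hpre' : ∀ a ∈ q.support, ∃ a' ∈ p.support, f a' = f a := fun a ha => by
    have : f a ∈ (p.map f).support := hpq ▸ (PMF.mem_support_map_iff _ _ _).2 ⟨a, ha, rfl⟩
    exact (PMF.mem_support_map_iff _ _ _).1 this
  obtain ⟨k, hk⟩ := exists_factor p f (fun a => (κ a).map g) fun a ha a' ha' haa => by
    obtain ⟨b, hb, hfb⟩ := hpre a ha
    rw [h a ha b hb hfb.symm, h a' ha' b hb (haa ▸ hfb.symm)]
  rw [PMF.map_bind, PMF.map_bind, bind_congr_support p (g := k ∘ f) hk,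
    bind_congr_support q (g := k ∘ f), ← PMF.bind_map, ← PMF.bind_map, hpq]
  intro a ha
  obtain ⟨b, hb, hfb⟩ := hpre' a ha
  rw [← h b hb a ha hfb, hk b hb, hfb, Function.comp]

/-- Disintegration of `q` along `g`. -/
theorem exists_disintegration (q : PMF A) (g : A → B) :
    ∃ k : B → PMF A, (∀ b ∈ (q.map g).support, ∀ a ∈ (k b).support, g a = b) ∧
      (q.map g).bind k = q := by
  classical
  refine ⟨fun b => if h : ∃ a ∈ g ⁻¹' {b}, a ∈ q.support then q.filter _ h else q, ?_, ?_⟩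
  · intro b hb a ha
    have h : ∃ a ∈ g ⁻¹' {b}, a ∈ q.support := by
      obtain ⟨a, ha, hab⟩ := (PMF.mem_support_map_iff _ _ _).1 hb
      exact ⟨a, hab, ha⟩
    simp only [dif_pos h, PMF.mem_support_filter_iff] at ha
    exact ha.1
  · ext a
    rw [PMF.bind_apply, tsum_eq_single (g a)]
    · have hm : (q.map g) (g a) = ∑' x, (g ⁻¹' {g a}).indicator q x := by
        rw [PMF.map_apply]
        refine tsum_congr fun x => ?_
        simp only [Set.indicator_apply, Set.mem_preimage, Set.mem_singleton_iff, eq_comm]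
      split_ifs with h
      · obtain ⟨b, hb, hbq⟩ := h
        rw [filter_apply_comm, ← mul_assoc, ← hm, ENNReal.mul_inv_cancel, one_mul,
          Set.indicator_of_mem (show a ∈ g ⁻¹' {g a} from rfl)]
        · exact (PMF.mem_support_iff _ _).1 ((PMF.mem_support_map_iff _ _ _).2 ⟨b, hbq, hb⟩)
        · exact PMF.apply_ne_top _ _
      · have : q a = 0 := by
          by_contra h0
          exact h ⟨a, rfl, h0⟩
        rw [this, mul_zero]
    · intro b hb
      split_ifs with h
      · rw [PMF.filter_apply_eq_zero_of_notMem _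
          fun ha : a ∈ g ⁻¹' {b} => hb (Eq.symm ha), mul_zero]
      · have : (q.map g) b = 0 := by
          by_contra h0
          obtain ⟨a, ha, hab⟩ := (PMF.mem_support_map_iff _ _ _).1 ((PMF.mem_support_iff _ _).2 h0)
          exact h ⟨a, hab, ha⟩
        rw [this, zero_mul]

/-- Distributions with a common image are the marginals of a distribution on the fibre
product. -/
theorem exists_coupling_of_map_eq (p : PMF A) (q : PMF B) (f : A → C) (g : B → C)
    (h : p.map f = q.map g) :
    ∃ r : PMF (A × B), r.map Prod.fst = p ∧ r.map Prod.snd = q ∧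
      ∀ x ∈ r.support, f x.1 = g x.2 := by
  obtain ⟨k, hk, hq⟩ := exists_disintegration q g
  refine ⟨p.bind fun a => (k (f a)).map (Prod.mk a), ?_, ?_, ?_⟩
  · rw [PMF.map_bind]
    simp only [PMF.map_comp]
    exact (congrArg p.bind (funext fun a => PMF.map_const _ _)).trans (PMF.bind_pure p)
  · rw [PMF.map_bind]
    simp only [PMF.map_comp]
    conv_rhs => rw [← hq, ← h, PMF.bind_map]
    exact congrArg p.bind (funext fun a => PMF.map_id _)
  · intro x hx
    obtain ⟨a, ha, hx⟩ := (PMF.mem_support_bind_iff _ _ _).1 hx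
    obtain ⟨b, hb, rfl⟩ := (PMF.mem_support_map_iff _ _ _).1 hx
    exact (hk (f a) (h ▸ (PMF.mem_support_map_iff _ _ _).2 ⟨a, ha, rfl⟩) b hb).symm

/-- The product of two distributions. -/
noncomputable def indepProd (p : PMF A) (q : PMF B) : PMF (A × B) :=
  p.bind fun a => q.map (Prod.mk a)

theorem indepProd_apply (p : PMF A) (q : PMF B) (a : A) (b : B) :
    indepProd p q (a, b) = p a * q b := by
  classical
  rw [indepProd, PMF.bind_apply, tsum_eq_single a, PMF.map_apply, tsum_eq_single b]
  · simp
  · intro b' hb; simp [hb.symm]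
  · intro a' ha
    rw [PMF.map_apply, ENNReal.tsum_eq_zero.2, mul_zero]
    intro b'; simp [ha.symm]

theorem map_fst_indepProd (p : PMF A) (q : PMF B) : (indepProd p q).map Prod.fst = p := by
  rw [indepProd, PMF.map_bind]
  simp only [PMF.map_comp]
  exact (congrArg p.bind (funext fun a => PMF.map_const _ _)).trans (PMF.bind_pure p)

theorem map_snd_indepProd (p : PMF A) (q : PMF B) : (indepProd p q).map Prod.snd = q := by
  rw [indepProd, PMF.map_bind]
  simp only [PMF.map_comp]
  exact (congrArg p.bind (funext fun a => PMF.map_id _)).trans (PMF.bind_const p q)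

theorem map_indepProd (p : PMF A) (q : PMF B) (f : A → C) (g : B → D) :
    (indepProd p q).map (fun x => (f x.1, g x.2)) = indepProd (p.map f) (q.map g) := by
  rw [indepProd, indepProd, PMF.map_bind, PMF.bind_map]
  refine congrArg p.bind (funext fun a => ?_)
  rw [Function.comp, PMF.map_comp, PMF.map_comp]
  rfl

theorem filter_indepProd (p : PMF A) (q : PMF B) (t : Set B)
    (h : ∃ x ∈ {x : A × B | x.2 ∈ t}, x ∈ (indepProd p q).support)
    (h' : ∃ b ∈ t, b ∈ q.support) :
    (indepProd p q).filter {x | x.2 ∈ t} h = indepProd p (q.filter t h') := by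
  refine eq_of_proportional (r := {x : A × B | x.2 ∈ t}.indicator (indepProd p q))
    (c' := (∑' x, t.indicator q x)⁻¹) (filter_apply_comm _ _ h) fun x => ?_
  obtain ⟨a, b⟩ := x
  rw [indepProd_apply, filter_apply_comm]
  by_cases hb : b ∈ t
  · rw [Set.indicator_of_mem hb, Set.indicator_of_mem (show (a, b) ∈ {x : A × B | x.2 ∈ t} from hb),
      indepProd_apply]
    ring
  · rw [Set.indicator_of_notMem hb,
      Set.indicator_of_notMem (show (a, b) ∉ {x : A × B | x.2 ∈ t} from hb)]
    ring

theorem convComb_indepProd_right (ρ : ℝ≥0∞) (hρ : ρ ≤ 1) (p : PMF A) (q q' : PMF B) :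
    convComb ρ hρ (indepProd p q) (indepProd p q') = indepProd p (convComb ρ hρ q q') := by
  ext ⟨a, b⟩
  simp only [convComb_apply, indepProd_apply]
  ring

/-- Independence of two random variables `X` and `Y` on a discrete probability space. -/
def Indep (p : PMF A) (X : A → B) (Y : A → C) : Prop :=
  p.map (fun a => (X a, Y a)) = indepProd (p.map X) (p.map Y)

theorem Indep.of_map_eq {p : PMF A} {X : A → B} {Y : A → C} {q : PMF B} {r : PMF C}
    (h : p.map (fun a => (X a, Y a)) = indepProd q r) :
    Indep p X Y ∧ p.map X = q ∧ p.map Y = r := by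
  have hX : p.map X = q := by
    rw [← map_fst_indepProd q r, ← h, PMF.map_comp]; rfl
  have hY : p.map Y = r := by
    rw [← map_snd_indepProd q r, ← h, PMF.map_comp]; rfl
  exact ⟨by rw [Indep, h, hX, hY], hX, hY⟩

theorem Indep.comp {B' C' : Type} {p : PMF A} {X : A → B} {Y : A → C} (h : Indep p X Y)
    (f : B → B') (g : C → C') : Indep p (fun a => f (X a)) (fun a => g (Y a)) := by
  refine (Indep.of_map_eq (q := (p.map X).map f) (r := (p.map Y).map g) ?_).1
  rw [← map_indepProd, ← h, PMF.map_comp]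
  rfl

/-- Conditioning on an event that depends on `Y` keeps `X` and `Y` independent and does not
change the distribution of `X`. -/
theorem Indep.filter {p : PMF A} {X : A → B} {Y : A → C} (h : Indep p X Y) (s : Set A)
    (t : Set C) (hst : ∀ a, a ∈ s ↔ Y a ∈ t) (hs : ∃ a ∈ s, a ∈ p.support) :
    Indep (p.filter s hs) X Y ∧ (p.filter s hs).map X = p.map X := by
  have ht : ∃ c ∈ t, c ∈ (p.map Y).support := by
    obtain ⟨a, ha, hap⟩ := hs
    exact ⟨Y a, (hst a).1 ha, (PMF.mem_support_map_iff _ _ _).2 ⟨a, hap, rfl⟩⟩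
  have ht' : ∃ x ∈ {x : B × C | x.2 ∈ t}, x ∈ (p.map fun a => (X a, Y a)).support := by
    obtain ⟨a, ha, hap⟩ := hs
    exact ⟨(X a, Y a), (hst a).1 ha, (PMF.mem_support_map_iff _ _ _).2 ⟨a, hap, rfl⟩⟩
  have key : (p.filter s hs).map (fun a => (X a, Y a)) =
      indepProd (p.map X) ((p.map Y).filter t ht) := by
    rw [map_filter_preimage p _ s {x | x.2 ∈ t} hst hs ht']
    simp only [show p.map (fun a => (X a, Y a)) = _ from h]
    exact filter_indepProd _ _ _ _ ht
  exact ⟨(Indep.of_map_eq key).1, (Indep.of_map_eq key).2.1⟩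

/-- If the law of the output `U` depends on `X` only, and the output `W` is a copy of `Y`, then
`U` and `W` are independent whenever `X` and `Y` are. -/
theorem Indep.bind {E F : Type} {p : PMF A} {X : A → B} {Y : A → C} (h : Indep p X Y)
    (κ : A → PMF D) (U : D → E) (W : D → F) (Z : C → F)
    (hX : ∀ a ∈ p.support, ∀ a' ∈ p.support, X a = X a' → (κ a).map U = (κ a').map U)
    (hW : ∀ a ∈ p.support, ∀ d ∈ (κ a).support, W d = Z (Y a)) :
    Indep (p.bind κ) U W := by
  obtain ⟨g, hg⟩ := exists_factor p X (fun a => (κ a).map U) hX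
  refine (Indep.of_map_eq (q := (p.map X).bind g) (r := (p.map Y).map Z) ?_).1
  have h1 : (p.bind κ).map (fun d => (U d, W d)) =
      (p.map fun a => (X a, Y a)).bind fun x => (g x.1).map fun u => (u, Z x.2) := by
    rw [PMF.map_bind, PMF.bind_map]
    refine bind_congr_support p fun a ha => ?_
    rw [map_congr_support (κ a) (g := (fun u => (u, Z (Y a))) ∘ U), ← PMF.map_comp, hg a ha]
    · rfl
    · intro d hd
      rw [hW a ha d hd, Function.comp]
  rw [h1, show p.map (fun a => (X a, Y a)) = _ from h, indepProd, indepProd]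
  simp only [PMF.bind_bind, PMF.map, Function.comp_def, PMF.pure_bind]
  refine congrArg p.bind (funext fun a => ?_)
  exact PMF.bind_comm _ _ _

end Distributions

/-! ### Memories and marginals -/

section Memories

variable {V : Type} (F : V → Type)

theorem restr_glue {S₁ S₁' S₂ S₂' : Set V} (h₁ : S₁ ⊆ S₁') (h₂ : S₂ ⊆ S₂')
    (h : S₁ ∪ S₂ ⊆ S₁' ∪ S₂') {m : ∀ x : S₁', F x} {m' : ∀ x : S₂', F x} (hm : Agree F m m') :
    restr F h (glue F m m') = glue F (restr F h₁ m) (restr F h₂ m') := by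
  funext x
  obtain ⟨x, hx⟩ := x
  by_cases hx₁ : x ∈ S₁
  · simp only [restr, glue, dif_pos hx₁, dif_pos (h₁ hx₁)]
  · by_cases hx₁' : x ∈ S₁'
    · simp only [restr, glue, dif_neg hx₁, dif_pos hx₁']
      exact hm x hx₁' _
    · simp only [restr, glue, dif_neg hx₁, dif_neg hx₁']

theorem restr_left_glue {S S' : Set V} (h : S ⊆ S ∪ S') (m : ∀ x : S, F x) (m' : ∀ x : S', F x) :
    restr F h (glue F m m') = m := by
  funext x
  simp only [restr, glue, dif_pos x.2]

theorem restr_right_glue {S S' : Set V} (h : S' ⊆ S ∪ S') {m : ∀ x : S, F x}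
    {m' : ∀ x : S', F x} (hm : Agree F m m') : restr F h (glue F m m') = m' := by
  funext x
  by_cases hx : (x : V) ∈ S
  · simp only [restr, glue, dif_pos hx]
    exact hm x hx x.2
  · simp only [restr, glue, dif_neg hx]

theorem glue_restr {S S' S'' : Set V} (h : S ⊆ S'') (h' : S' ⊆ S'') (h'' : S ∪ S' ⊆ S'')
    (m : ∀ x : S'', F x) : glue F (restr F h m) (restr F h' m) = restr F h'' m := by
  funext x
  by_cases hx : (x : V) ∈ S <;> simp only [restr, glue, hx, dite_true, dite_false]

theorem Agree.of_disjoint {S S' : Set V} (h : Disjoint S S') (m : ∀ x : S, F x)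
    (m' : ∀ x : S', F x) : Agree F m m' :=
  fun _ hx hx' => (Set.disjoint_left.1 h hx hx').elim

theorem upd_same (m : ∀ x : (Set.univ : Set V), F x) (x : V) (v : F x)
    (h : x ∈ (Set.univ : Set V)) : upd F m x v ⟨x, h⟩ = v := by
  simp [upd]

theorem upd_of_ne (m : ∀ x : (Set.univ : Set V), F x) {x y : V} (v : F x)
    (h : y ∈ (Set.univ : Set V)) (hxy : y ≠ x) : upd F m x v ⟨y, h⟩ = m ⟨y, h⟩ := by
  unfold upd Function.update
  refine dif_neg ?_
  exact fun he => hxy (congrArg Subtype.val he)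

end Memories

/-- The marginal of a distribution over random memories on a smaller domain. -/
noncomputable def marg {T T' : Set L.RV} (h : T ⊆ T') (μ : PMF (RanM L T')) : PMF (RanM L T) :=
  μ.map (restr (RVal L) h)

theorem marg_self {T : Set L.RV} (h : T ⊆ T) (μ : PMF (RanM L T)) : marg h μ = μ :=
  μ.map_id

theorem marg_marg {T T' T'' : Set L.RV} (h : T ⊆ T') (h' : T' ⊆ T'') (μ : PMF (RanM L T'')) :
    marg h (marg h' μ) = marg (h.trans h') μ :=
  μ.map_comp _ _

theorem prodDist_eq_map {T T' : Set L.RV} (μ : PMF (RanM L T)) (μ' : PMF (RanM L T')) :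
    prodDist μ μ' = (indepProd μ μ').map fun x => glue (RVal L) x.1 x.2 := by
  rw [prodDist, indepProd, PMF.map_bind]
  refine congrArg μ.bind (funext fun m => ?_)
  rw [PMF.map_comp]
  rfl

theorem map_restr_prodDist {T T' : Set L.RV} (hd : Disjoint T T') (h : T ⊆ T ∪ T')
    (h' : T' ⊆ T ∪ T') (μ : PMF (RanM L T)) (μ' : PMF (RanM L T')) :
    (prodDist μ μ').map (fun m => (restr (RVal L) h m, restr (RVal L) h' m)) =
      indepProd μ μ' := by
  rw [prodDist_eq_map, PMF.map_comp]
  refine (congrArg (fun f => (indepProd μ μ').map f) (funext fun x => ?_)).trans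
    (PMF.map_id _)
  simp only [Function.comp, restr_left_glue,
    restr_right_glue _ _ (Agree.of_disjoint _ hd x.1 x.2), id]

theorem marg_prodDist {T₁ T₁' T₂ T₂' : Set L.RV} (h₁ : T₁ ⊆ T₁') (h₂ : T₂ ⊆ T₂')
    (h : T₁ ∪ T₂ ⊆ T₁' ∪ T₂') (hd : Disjoint T₁' T₂') (μ : PMF (RanM L T₁'))
    (μ' : PMF (RanM L T₂')) :
    marg h (prodDist μ μ') = prodDist (marg h₁ μ) (marg h₂ μ') := by
  rw [prodDist_eq_map, prodDist_eq_map, marg, marg, marg, ← map_indepProd, PMF.map_comp,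
    PMF.map_comp]
  refine congrArg (fun f => (indepProd μ μ').map f) (funext fun x => ?_)
  exact restr_glue _ h₁ h₂ h (Agree.of_disjoint _ hd _ _)

/-- Two disjoint parts of a random memory are independent if and only if the marginal on their
union is the product of their marginals. -/
theorem indep_restr_iff {T T₁ T₂ : Set L.RV} (h₁ : T₁ ⊆ T) (h₂ : T₂ ⊆ T) (h : T₁ ∪ T₂ ⊆ T)
    (hd : Disjoint T₁ T₂) (μ : PMF (RanM L T)) :
    Indep μ (restr (RVal L) h₁) (restr (RVal L) h₂) ↔
      prodDist (marg h₁ μ) (marg h₂ μ) = marg h μ := by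
  constructor
  · intro hi
    rw [prodDist_eq_map, marg, marg, ← hi, PMF.map_comp]
    exact congrArg (fun f => μ.map f) (funext fun m => glue_restr _ h₁ h₂ h m)
  · intro he
    rw [Indep]
    refine Eq.trans ?_
      (map_restr_prodDist hd Set.subset_union_left Set.subset_union_right _ _)
    rw [show PMF.map (restr (RVal L) h₁) μ = marg h₁ μ from rfl,
      show PMF.map (restr (RVal L) h₂) μ = marg h₂ μ from rfl, he, marg, PMF.map_comp]
    rfl

theorem indep_restr_mono {T T₁ T₂ V₁ V₂ : Set L.RV} {h₁ : T₁ ⊆ T} {h₂ : T₂ ⊆ T}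
    {μ : PMF (RanM L T)} (hi : Indep μ (restr (RVal L) h₁) (restr (RVal L) h₂)) (k₁ : V₁ ⊆ T₁)
    (k₂ : V₂ ⊆ T₂) :
    Indep μ (restr (RVal L) (k₁.trans h₁)) (restr (RVal L) (k₂.trans h₂)) :=
  hi.comp (restr (RVal L) k₁) (restr (RVal L) k₂)

theorem indep_restr_marg {T T' T₁ T₂ : Set L.RV} (h : T ⊆ T') (h₁ : T₁ ⊆ T) (h₂ : T₂ ⊆ T)
    (μ : PMF (RanM L T'))
    (hi : Indep μ (restr (RVal L) (h₁.trans h)) (restr (RVal L) (h₂.trans h))) :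
    Indep (marg h μ) (restr (RVal L) h₁) (restr (RVal L) h₂) := by
  rw [Indep, marg, PMF.map_comp, PMF.map_comp, PMF.map_comp]
  exact hi

/-- Distributions that agree on their common variables are marginals of one distribution. -/
theorem exists_amalgam {T U V : Set L.RV} (hVT : V ⊆ T) (hVU : V ⊆ U) (hTU : T ∩ U ⊆ V)
    (μ : PMF (RanM L T)) (ν : PMF (RanM L U)) (h : marg hVT μ = marg hVU ν) :
    ∃ ξ : PMF (RanM L (T ∪ U)), marg Set.subset_union_left ξ = μ ∧
      marg Set.subset_union_right ξ = ν := by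
  obtain ⟨r, hr₁, hr₂, hr⟩ := exists_coupling_of_map_eq μ ν _ _ h
  refine ⟨r.map fun x => glue (RVal L) x.1 x.2, ?_, ?_⟩
  · rw [marg, PMF.map_comp, ← hr₁]
    exact congrArg (fun f => r.map f) (funext fun x => restr_left_glue _ _ _ _)
  · rw [marg, PMF.map_comp, ← hr₂]
    refine map_congr_support r fun x hx => restr_right_glue _ _ fun y hy hy' => ?_
    exact congrFun (hr x hx) ⟨y, hTU ⟨hy, hy'⟩⟩

/-! ### Expressions -/

theorem subset_domain_univ_iff {A : Set (Var L)} {T : Set L.RV} :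
    A ⊆ domain Set.univ T ↔ randomVars A ⊆ T := by
  constructor
  · exact fun h x hx => h hx
  · rintro h (x | x) hx
    · trivial
    · exact h hx

theorem DExp.eval_congr {S S' : Set L.DV} {T T' : Set L.RV} {σ : DetM L S} {σ' : DetM L S'}
    {t : L.Ty} (e : DExp L t) (h : e.fv ⊆ domain S T) (h' : e.fv ⊆ domain S' T')
    (hσ : ∀ x (hx : x ∈ S) (hx' : x ∈ S'), Sum.inl x ∈ e.fv → σ ⟨x, hx⟩ = σ' ⟨x, hx'⟩) :
    e.eval σ h = e.eval σ' h' := by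
  induction e with
  | var x => exact hσ x _ _ rfl
  | lit b => rfl
  | op f args ih =>
    simp only [DExp.eval]
    congr 1
    funext i
    exact ih i _ _ fun x hx hx' hi => hσ x hx hx' (Set.mem_iUnion.2 ⟨i, hi⟩)

theorem RExp.eval_congr {S S' : Set L.DV} {T T' : Set L.RV} {σ : DetM L S} {σ' : DetM L S'}
    {m : RanM L T} {m' : RanM L T'} {t : L.Ty} (e : RExp L t) (h : e.fv ⊆ domain S T)
    (h' : e.fv ⊆ domain S' T')
    (hσ : ∀ x (hx : x ∈ S) (hx' : x ∈ S'), Sum.inl x ∈ e.fv → σ ⟨x, hx⟩ = σ' ⟨x, hx'⟩)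
    (hm : ∀ x (hx : x ∈ T) (hx' : x ∈ T'), Sum.inr x ∈ e.fv → m ⟨x, hx⟩ = m' ⟨x, hx'⟩) :
    e.eval σ m h = e.eval σ' m' h' := by
  induction e with
  | det e => exact e.eval_congr _ _ hσ
  | var x => exact hm x _ _ rfl
  | op f args ih =>
    simp only [RExp.eval]
    congr 1
    funext i
    exact ih i _ _ (fun x hx hx' hi => hσ x hx hx' (Set.mem_iUnion.2 ⟨i, hi⟩))
      fun x hx hx' hi => hm x hx hx' (Set.mem_iUnion.2 ⟨i, hi⟩)

theorem DExp.randomVars_fv {t : L.Ty} (e : DExp L t) : randomVars e.fv = ∅ := by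
  induction e with
  | var x => ext y; simp [randomVars, DExp.fv]
  | lit b => ext y; simp [randomVars, DExp.fv]
  | op f args ih =>
    ext y
    have := fun i => Set.ext_iff.1 (ih i) y
    simpa [randomVars, DExp.fv] using this

theorem DExp.fv_subset_domain {t : L.Ty} (e : DExp L t) (T : Set L.RV) :
    e.fv ⊆ domain Set.univ T :=
  subset_domain_univ_iff.2 (e.randomVars_fv ▸ Set.empty_subset _)

theorem RExp.randomVars_fv_subst (x : L.DV) (d : DExp L (L.dty x)) {t : L.Ty} (e : RExp L t) :
    randomVars (e.subst x d).fv = randomVars e.fv := by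
  induction e with
  | det e => exact ((DExp.subst x d e).randomVars_fv).trans e.randomVars_fv.symm
  | var y => rfl
  | op f args ih =>
    ext y
    have := fun i => Set.ext_iff.1 (ih i) y
    simp only [randomVars, Set.mem_ofPred_eq] at this
    simp [randomVars, RExp.fv, RExp.subst, this]

theorem RExp.fv_subst_subset_iff (x : L.DV) (d : DExp L (L.dty x)) {t : L.Ty} (e : RExp L t)
    (T : Set L.RV) : (e.subst x d).fv ⊆ domain Set.univ T ↔ e.fv ⊆ domain Set.univ T := by
  rw [subset_domain_univ_iff, subset_domain_univ_iff, RExp.randomVars_fv_subst]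

theorem DExp.eval_of_eq {S : Set L.DV} {T : Set L.RV} {σ : DetM L S} {t : L.Ty} {e e' : DExp L t}
    (he : e = e') (h : e.fv ⊆ domain S T) (h' : e'.fv ⊆ domain S T) :
    e.eval σ h = e'.eval σ h' := by
  subst he
  rfl

theorem DExp.eval_subst {T : Set L.RV} (σ : DetM L Set.univ) (x : L.DV) (d : DExp L (L.dty x))
    {t : L.Ty} (e : DExp L t) (h : (DExp.subst x d e).fv ⊆ domain Set.univ T)
    (h' : e.fv ⊆ domain Set.univ T) :
    (DExp.subst x d e).eval σ h =
      e.eval (upd (DVal L) σ x (d.eval σ (subset_domain_univ _))) h' := by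
  induction e with
  | var y =>
    by_cases hxy : x = y
    · subst hxy
      exact (eval_of_eq (dif_pos rfl) h (d.fv_subset_domain T)).trans
        ((d.eval_congr _ _ fun _ _ _ _ => rfl).trans (upd_same (DVal L) _ _ _ _).symm)
    · exact (eval_of_eq (dif_neg hxy) h h').trans
        (upd_of_ne (DVal L) _ _ _ (Ne.symm hxy)).symm
  | lit b => rfl
  | op f args ih =>
    simp only [DExp.eval, DExp.subst]
    congr 1
    funext i
    exact ih i _ _

theorem RExp.eval_subst {T : Set L.RV} (σ : DetM L Set.univ) (m : RanM L T) (x : L.DV)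
    (d : DExp L (L.dty x)) {t : L.Ty} (e : RExp L t)
    (h : (RExp.subst x d e).fv ⊆ domain Set.univ T) (h' : e.fv ⊆ domain Set.univ T) :
    (RExp.subst x d e).eval σ m h =
      e.eval (upd (DVal L) σ x (d.eval σ (subset_domain_univ _))) m h' := by
  induction e with
  | det e => exact DExp.eval_subst σ x d e _ _
  | var y => rfl
  | op f args ih =>
    simp only [RExp.eval, RExp.subst]
    congr 1
    funext i
    exact ih i _ _

/-! ### Monotonicity of satisfaction -/

theorem World.le_trans {w w' w'' : World L} (h : w.le w') (h' : w'.le w'') : w.le w'' := by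
  obtain ⟨hS, hT, hσ, hμ⟩ := h
  obtain ⟨hS', hT', hσ', hμ'⟩ := h'
  refine ⟨hS.trans hS', hT.trans hT', ?_, ?_⟩
  · rw [hσ, hσ']; rfl
  · rw [hμ, hμ', PMF.map_comp]; rfl

theorem World.le_refl (w : World L) : w.le w :=
  ⟨subset_rfl, subset_rfl, rfl, (PMF.map_id _).symm⟩

theorem World.Compat.mono {w₁ w₂ w₁' w₂' : World L} (h : w₁'.Compat w₂') (h₁ : w₁.le w₁')
    (h₂ : w₂.le w₂') : w₁.Compat w₂ := by
  obtain ⟨hS, hT, hσ, hμ⟩ := h₁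
  obtain ⟨hS', hT', hσ', hμ'⟩ := h₂
  refine ⟨fun x hx hx' => ?_, h.2.mono hT hT'⟩
  rw [hσ, hσ']
  exact h.1 x _ _

theorem World.comb_le_comb {w₁ w₂ w₁' w₂' : World L} (h : w₁'.Compat w₂') (h₁ : w₁.le w₁')
    (h₂ : w₂.le w₂') : (w₁.comb w₂).le (w₁'.comb w₂') := by
  obtain ⟨hS, hT, hσ, hμ⟩ := h₁
  obtain ⟨hS', hT', hσ', hμ'⟩ := h₂
  refine ⟨Set.union_subset_union hS hS', Set.union_subset_union hT hT', ?_, ?_⟩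
  · simp only [World.comb]
    rw [hσ, hσ']
    exact (restr_glue _ _ _ _ h.1).symm
  · simp only [World.comb]
    rw [hμ, hμ']
    exact (marg_prodDist hT hT' _ h.2 _ _).symm

theorem sat_mono {φ : Form L} {w w' : World L} (h : w.le w') (hw : Sat w φ) : Sat w' φ := by
  induction φ generalizing w w' with
  | unif S hS e =>
    obtain ⟨hd, hu⟩ := hw
    obtain ⟨kS, kT, hσ, hμ⟩ := h
    have hd' : e.fv ⊆ w'.dom := fun x hx => by
      have := hd hx
      rcases x with x | x
      exacts [kS this, kT this]
    refine ⟨hd', fun v hv => ?_⟩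
    rw [← hu v hv, hμ, PMF.map_comp]
    congr 2
    funext m
    refine e.eval_congr _ _ (fun x _ hx' _ => ?_) fun x _ hx' _ => rfl
    rw [hσ]; rfl
  | eqv e e' =>
    obtain ⟨hd, hd', hu⟩ := hw
    obtain ⟨kS, kT, hσ, hμ⟩ := h
    have hdom : w.dom ⊆ w'.dom := fun x hx => by
      rcases x with x | x
      exacts [kS hx, kT hx]
    refine ⟨hd.trans hdom, hd'.trans hdom, fun m hm => ?_⟩
    have := hu (restr _ kT m) (by rw [hμ]; exact (PMF.mem_support_map_iff _ _ _).2 ⟨m, hm, rfl⟩)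
    refine Eq.trans ?_ (this.trans ?_)
    · exact e.eval_congr _ _ (fun x _ _ _ => by rw [hσ]; rfl) fun x _ _ _ => rfl
    · exact e'.eval_congr _ _ (fun x _ _ _ => by rw [hσ]; rfl) fun x _ _ _ => rfl
  | deq e e' =>
    obtain ⟨hd, hd', hu⟩ := hw
    obtain ⟨kS, kT, hσ, hμ⟩ := h
    have hdom : w.dom ⊆ w'.dom := fun x hx => by
      rcases x with x | x
      exacts [kS hx, kT hx]
    refine ⟨hd.trans hdom, hd'.trans hdom, Eq.trans ?_ (hu.trans ?_)⟩
    · exact e.eval_congr _ _ fun x _ _ _ => by rw [hσ]; rfl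
    · exact e'.eval_congr _ _ fun x _ _ _ => by rw [hσ]; rfl
  | dpred p args =>
    obtain ⟨hd, hu⟩ := hw
    obtain ⟨kS, kT, hσ, hμ⟩ := h
    have hdom : w.dom ⊆ w'.dom := fun x hx => by
      rcases x with x | x
      exacts [kS hx, kT hx]
    refine ⟨fun i => (hd i).trans hdom, ?_⟩
    convert hu using 2 with i
    exact (args i).eval_congr _ _ fun x _ _ _ => by rw [hσ]; rfl
  | top => trivial
  | bot => exact hw
  | and φ ψ ihφ ihψ => exact ⟨ihφ h hw.1, ihψ h hw.2⟩
  | or φ ψ ihφ ihψ => exact hw.imp (ihφ h) (ihψ h)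
  | imp φ ψ => exact fun w'' h' => hw w'' (World.le_trans h h')
  | sep φ ψ =>
    obtain ⟨w₁, w₂, hc, hle, h₁, h₂⟩ := hw
    exact ⟨w₁, w₂, hc, World.le_trans hle h, h₁, h₂⟩
  | wand φ ψ _ ihψ =>
    exact fun w'' h' hc => ihψ (World.comb_le_comb hc h w''.le_refl)
      (hw w'' h' (hc.mono h w''.le_refl))

/-! ### Satisfaction over total deterministic memories -/

/-- A world whose deterministic memory is total. -/
abbrev full (σ : DetM L Set.univ) {T : Set L.RV} (μ : PMF (RanM L T)) : World L :=
  ⟨Set.univ, T, σ, μ⟩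

theorem full_le_full (σ : DetM L Set.univ) {T T' : Set L.RV} (h : T ⊆ T') (μ : PMF (RanM L T')) :
    (full σ (marg h μ)).le (full σ μ) :=
  ⟨subset_rfl, h, rfl, rfl⟩

theorem sat_of_sat_marg {φ : Form L} {σ : DetM L Set.univ} {T T' : Set L.RV} {h : T ⊆ T'}
    {μ : PMF (RanM L T')} (hs : Sat (full σ (marg h μ)) φ) : Sat (full σ μ) φ :=
  sat_mono (full_le_full σ h μ) hs

theorem sat_full_imp {φ ψ : Form L} {σ : DetM L Set.univ} {T : Set L.RV} {μ : PMF (RanM L T)} :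
    Sat (full σ μ) (.imp φ ψ) ↔ ∀ (T' : Set L.RV) (h : T ⊆ T') (μ' : PMF (RanM L T')),
      μ = marg h μ' → Sat (full σ μ') φ → Sat (full σ μ') ψ := by
  constructor
  · intro hs T' h μ' hμ
    exact hs (full σ μ') ⟨subset_rfl, h, rfl, hμ⟩
  · rintro hs ⟨S', T', σ', μ'⟩ ⟨hS, hT, hσ, hμ⟩
    obtain rfl : S' = Set.univ := Set.univ_subset_iff.1 hS
    obtain rfl : σ = σ' := hσ
    exact hs T' hT μ' hμ

/-- A separating conjunction splits the random variables into two independent parts; the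
deterministic memory is shared. -/
theorem sat_full_sep {φ ψ : Form L} {σ : DetM L Set.univ} {T : Set L.RV} {μ : PMF (RanM L T)} :
    Sat (full σ μ) (.sep φ ψ) ↔ ∃ (T₁ T₂ : Set L.RV) (h₁ : T₁ ⊆ T) (h₂ : T₂ ⊆ T),
      Disjoint T₁ T₂ ∧ Indep μ (restr (RVal L) h₁) (restr (RVal L) h₂) ∧
      Sat (full σ (marg h₁ μ)) φ ∧ Sat (full σ (marg h₂ μ)) ψ := by
  constructor
  · rintro ⟨⟨S₁, T₁, σ₁, μ₁⟩, ⟨S₂, T₂, σ₂, μ₂⟩, ⟨hσc, hd⟩, ⟨hS, hT, hσ, hμ⟩, h₁, h₂⟩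
    simp only [World.comb] at hS hT hσ hμ hσc hd
    have hT₁ : T₁ ⊆ T := Set.subset_union_left.trans hT
    have hT₂ : T₂ ⊆ T := Set.subset_union_right.trans hT
    have hsplit := map_restr_prodDist hd Set.subset_union_left Set.subset_union_right μ₁ μ₂
    rw [hμ, PMF.map_comp] at hsplit
    have hind := Indep.of_map_eq (X := restr (RVal L) hT₁) (Y := restr (RVal L) hT₂) hsplit
    refine ⟨T₁, T₂, hT₁, hT₂, hd, hind.1, sat_mono ?_ h₁, sat_mono ?_ h₂⟩
    · refine ⟨Set.subset_univ _, subset_rfl, ?_, ?_⟩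
      · rw [← restr_left_glue (DVal L) Set.subset_union_left σ₁ σ₂, hσ]; rfl
      · rw [← hind.2.1]; exact (PMF.map_id _).symm
    · refine ⟨Set.subset_univ _, subset_rfl, ?_, ?_⟩
      · rw [← restr_right_glue (DVal L) Set.subset_union_right hσc, hσ]; rfl
      · rw [← hind.2.2]; exact (PMF.map_id _).symm
  · rintro ⟨T₁, T₂, hT₁, hT₂, hd, hi, h₁, h₂⟩
    refine ⟨full σ (marg hT₁ μ), full σ (marg hT₂ μ), ⟨fun x _ _ => rfl, hd⟩,
      ⟨Set.subset_univ _, Set.union_subset hT₁ hT₂, ?_, ?_⟩,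
      h₁, h₂⟩
    · exact glue_restr (DVal L) subset_rfl subset_rfl _ σ
    · exact (indep_restr_iff hT₁ hT₂ _ hd μ).1 hi

theorem sat_full_wand {φ ψ : Form L} {σ : DetM L Set.univ} {T : Set L.RV} {μ : PMF (RanM L T)} :
    Sat (full σ μ) (.wand φ ψ) ↔ ∀ (T' : Set L.RV) (μ' : PMF (RanM L T')), Disjoint T T' →
      Sat (full σ μ') φ → Sat (full σ (prodDist μ μ')) ψ := by
  constructor
  · intro hs T' μ' hd h
    refine sat_mono ?_ (hs (full σ μ') h ⟨fun _ _ _ => rfl, hd⟩)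
    exact ⟨Set.subset_univ _, subset_rfl, glue_restr (DVal L) subset_rfl subset_rfl _ σ,
      (PMF.map_id _).symm⟩
  · rintro hs ⟨S', T', σ', μ'⟩ h ⟨hσ, hd⟩
    have hσ' : σ' = restr (DVal L) (Set.subset_univ S') σ :=
      funext fun x => (hσ x trivial x.2).symm
    refine sat_mono ?_ (hs T' μ' hd (sat_mono ?_ h))
    · refine ⟨Set.subset_union_left, subset_rfl, ?_, (PMF.map_id _).symm⟩
      exact (restr_left_glue (DVal L) _ _ _).symm
    · exact ⟨Set.subset_univ _, subset_rfl, hσ', (PMF.map_id _).symm⟩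

/-! ### Free variables and substitution -/

theorem sat_congr_det {φ : Form L} {σ σ' : DetM L Set.univ} {T : Set L.RV} {μ : PMF (RanM L T)}
    (h : ∀ x, Sum.inl x ∈ φ.fv → σ ⟨x, trivial⟩ = σ' ⟨x, trivial⟩) (hs : Sat (full σ μ) φ) :
    Sat (full σ' μ) φ := by
  induction φ generalizing σ σ' T μ with
  | unif S hS e =>
    obtain ⟨hd, hu⟩ := hs
    refine ⟨hd, fun v hv => ?_⟩
    rw [← hu v hv]
    congr 2
    funext m
    exact e.eval_congr _ _ (fun x _ _ hx => (h x hx).symm) fun _ _ _ _ => rfl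
  | eqv e e' =>
    obtain ⟨hd, hd', hu⟩ := hs
    refine ⟨hd, hd', fun m hm => Eq.trans ?_ ((hu m hm).trans ?_)⟩
    · exact e.eval_congr _ _ (fun x _ _ hx => (h x (Or.inl hx)).symm) fun _ _ _ _ => rfl
    · exact e'.eval_congr _ _ (fun x _ _ hx => h x (Or.inr hx)) fun _ _ _ _ => rfl
  | deq e e' =>
    obtain ⟨hd, hd', hu⟩ := hs
    refine ⟨hd, hd', Eq.trans ?_ (hu.trans ?_)⟩
    · exact e.eval_congr _ _ fun x _ _ hx => (h x (Or.inl hx)).symm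
    · exact e'.eval_congr _ _ fun x _ _ hx => h x (Or.inr hx)
  | dpred p args =>
    obtain ⟨hd, hu⟩ := hs
    refine ⟨hd, ?_⟩
    convert hu using 2 with i
    exact (args i).eval_congr _ _ fun x _ _ hx => (h x (Set.mem_iUnion.2 ⟨i, hx⟩)).symm
  | top => trivial
  | bot => exact hs
  | and φ ψ ihφ ihψ =>
    exact ⟨ihφ (fun x hx => h x (Or.inl hx)) hs.1, ihψ (fun x hx => h x (Or.inr hx)) hs.2⟩
  | or φ ψ ihφ ihψ =>
    exact hs.imp (ihφ fun x hx => h x (Or.inl hx)) (ihψ fun x hx => h x (Or.inr hx))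
  | imp φ ψ ihφ ihψ =>
    rw [sat_full_imp] at hs ⊢
    exact fun T' hT μ' hμ hφ => ihψ (fun x hx => h x (Or.inr hx))
      (hs T' hT μ' hμ (ihφ (fun x hx => (h x (Or.inl hx)).symm) hφ))
  | sep φ ψ ihφ ihψ =>
    rw [sat_full_sep] at hs ⊢
    obtain ⟨T₁, T₂, h₁, h₂, hd, hi, hs₁, hs₂⟩ := hs
    exact ⟨T₁, T₂, h₁, h₂, hd, hi, ihφ (fun x hx => h x (Or.inl hx)) hs₁,
      ihψ (fun x hx => h x (Or.inr hx)) hs₂⟩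
  | wand φ ψ ihφ ihψ =>
    rw [sat_full_wand] at hs ⊢
    exact fun T' μ' hd hφ => ihψ (fun x hx => h x (Or.inr hx))
      (hs T' μ' hd (ihφ (fun x hx => (h x (Or.inl hx)).symm) hφ))

/-- Satisfaction depends only on the random variables that are free in the formula.  For an
implication, the given extension of the marginal is amalgamated with the original distribution
over their common variables. -/
theorem sat_marg {φ : Form L} {σ : DetM L Set.univ} {T V : Set L.RV} {μ : PMF (RanM L T)}
    (hVT : V ⊆ T) (hV : T ∩ randomVars φ.fv ⊆ V) (hs : Sat (full σ μ) φ) :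
    Sat (full σ (marg hVT μ)) φ := by
  induction φ generalizing T V μ with
  | unif S hS e =>
    obtain ⟨hd, hu⟩ := hs
    have hd' : e.fv ⊆ domain Set.univ V := subset_domain_univ_iff.2 fun x hx =>
      hV ⟨subset_domain_univ_iff.1 hd hx, hx⟩
    refine ⟨hd', fun v hv => ?_⟩
    rw [← hu v hv, marg, PMF.map_comp]
    congr 2
    funext m
    exact e.eval_congr _ _ (fun _ _ _ _ => rfl) fun _ _ _ _ => rfl
  | eqv e e' =>
    obtain ⟨hd, hd', hu⟩ := hs
    have hdV : e.fv ⊆ domain Set.univ V := subset_domain_univ_iff.2 fun x hx =>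
      hV ⟨subset_domain_univ_iff.1 hd hx, Or.inl hx⟩
    have hdV' : e'.fv ⊆ domain Set.univ V := subset_domain_univ_iff.2 fun x hx =>
      hV ⟨subset_domain_univ_iff.1 hd' hx, Or.inr hx⟩
    refine ⟨hdV, hdV', fun m hm => ?_⟩
    obtain ⟨m, hm', rfl⟩ := (PMF.mem_support_map_iff _ _ _).1 hm
    refine Eq.trans ?_ ((hu m hm').trans ?_)
    · exact e.eval_congr _ _ (fun _ _ _ _ => rfl) fun _ _ _ _ => rfl
    · exact e'.eval_congr _ _ (fun _ _ _ _ => rfl) fun _ _ _ _ => rfl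
  | deq e e' =>
    obtain ⟨hd, hd', hu⟩ := hs
    refine ⟨e.fv_subset_domain V, e'.fv_subset_domain V, Eq.trans ?_ (hu.trans ?_)⟩
    · exact e.eval_congr _ _ fun _ _ _ _ => rfl
    · exact e'.eval_congr _ _ fun _ _ _ _ => rfl
  | dpred p args =>
    obtain ⟨hd, hu⟩ := hs
    refine ⟨fun i => (args i).fv_subset_domain V, ?_⟩
    convert hu using 2 with i
    exact (args i).eval_congr _ _ fun _ _ _ _ => rfl
  | top => trivial
  | bot => exact hs
  | and φ ψ ihφ ihψ =>
    exact ⟨ihφ hVT (fun x hx => hV ⟨hx.1, Or.inl hx.2⟩) hs.1,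
      ihψ hVT (fun x hx => hV ⟨hx.1, Or.inr hx.2⟩) hs.2⟩
  | or φ ψ ihφ ihψ =>
    exact hs.imp (ihφ hVT fun x hx => hV ⟨hx.1, Or.inl hx.2⟩)
      (ihψ hVT fun x hx => hV ⟨hx.1, Or.inr hx.2⟩)
  | imp φ ψ ihφ ihψ =>
    rw [sat_full_imp] at hs ⊢
    intro T' hT' μ' hμ' hφ
    -- `U` adds to `V` only free variables of the implication, so it meets `T` in `V` only.
    let U : Set L.RV := T' ∩ (V ∪ randomVars (Form.imp φ ψ).fv)
    have hUT' : U ⊆ T' := Set.inter_subset_left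
    have hVU : V ⊆ U := fun x hx => ⟨hT' hx, Or.inl hx⟩
    have hTU : T ∩ U ⊆ V := fun x hx => hx.2.2.elim id fun hf => hV ⟨hx.1, hf⟩
    have hφU : Sat (full σ (marg hUT' μ')) φ :=
      ihφ hUT' (fun x hx => ⟨hx.1, Or.inr (Or.inl hx.2)⟩) hφ
    obtain ⟨ξ, hξ, hξ'⟩ := exists_amalgam hVT hVU hTU μ (marg hUT' μ')
      (by rw [marg_marg]; exact hμ')
    rw [← hξ'] at hφU
    have hψ := hs _ Set.subset_union_left ξ hξ.symm (sat_of_sat_marg hφU)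
    have hψU := ihψ (V := U) Set.subset_union_right
      (fun x hx => hx.1.elim (fun hxT => hVU (hV ⟨hxT, Or.inr hx.2⟩)) id) hψ
    rw [hξ'] at hψU
    exact sat_of_sat_marg hψU
  | sep φ ψ ihφ ihψ =>
    rw [sat_full_sep] at hs ⊢
    obtain ⟨T₁, T₂, h₁, h₂, hd, hi, hs₁, hs₂⟩ := hs
    refine ⟨T₁ ∩ V, T₂ ∩ V, Set.inter_subset_right, Set.inter_subset_right,
      hd.mono Set.inter_subset_left Set.inter_subset_left, ?_, ?_, ?_⟩
    · exact indep_restr_marg _ _ _ _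
        (indep_restr_mono hi Set.inter_subset_left Set.inter_subset_left)
    · have := ihφ (V := T₁ ∩ V) Set.inter_subset_left
        (fun x hx => ⟨hx.1, hV ⟨h₁ hx.1, Or.inl hx.2⟩⟩) hs₁
      rw [marg_marg] at this ⊢
      exact this
    · have := ihψ (V := T₂ ∩ V) Set.inter_subset_left
        (fun x hx => ⟨hx.1, hV ⟨h₂ hx.1, Or.inr hx.2⟩⟩) hs₂
      rw [marg_marg] at this ⊢
      exact this
  | wand φ ψ ihφ ihψ =>
    rw [sat_full_wand] at hs ⊢
    intro T' μ' hd hφ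
    -- Off the free variables of `φ` the domain `T'` may meet `T`; these variables are dropped.
    let U : Set L.RV := T' ∩ randomVars φ.fv
    have hUT' : U ⊆ T' := Set.inter_subset_left
    have hdU : Disjoint T U := Set.disjoint_left.2 fun x hx hxU =>
      Set.disjoint_left.1 hd (hV ⟨hx, Or.inl hxU.2⟩) hxU.1
    have hψ := hs U (marg hUT' μ') hdU (ihφ hUT' (fun x hx => hx) hφ)
    have hψ' := ihψ (V := V ∪ U) (Set.union_subset_union_left _ hVT)
      (fun x hx => hx.1.elim (fun hxT => Or.inl (hV ⟨hxT, Or.inr hx.2⟩)) Or.inr) hψ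
    rw [marg_prodDist hVT subset_rfl _ hdU, marg_self] at hψ'
    rw [← marg_self subset_rfl (marg hVT μ), ← marg_prodDist subset_rfl hUT'
      (Set.union_subset_union_right _ hUT') hd] at hψ'
    exact sat_of_sat_marg hψ'

theorem exists_prop_iff {p p' : Prop} {q : p → Prop} {q' : p' → Prop} (h : p ↔ p')
    (hq : ∀ k k', q k ↔ q' k') : (∃ k, q k) ↔ ∃ k', q' k' :=
  ⟨fun ⟨k, hk⟩ => ⟨h.1 k, (hq k _).1 hk⟩, fun ⟨k, hk⟩ => ⟨h.2 k, (hq _ k).2 hk⟩⟩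

/-- The separating connectives commute with the update of `x` because every world may be given the
same total deterministic memory. -/
theorem sat_subst {φ : Form L} {σ : DetM L Set.univ} {T : Set L.RV} {μ : PMF (RanM L T)}
    (x : L.DV) (d : DExp L (L.dty x)) :
    Sat (full σ μ) (φ.subst x d) ↔
      Sat (full (upd (DVal L) σ x (d.eval σ (subset_domain_univ _))) μ) φ := by
  induction φ generalizing T μ with
  | unif S hS e =>
    refine exists_prop_iff (e.fv_subst_subset_iff x d T) fun h h' => ?_
    simp only [RExp.eval_subst _ _ _ _ _ h h']
  | eqv e e' =>
    refine exists_prop_iff (e.fv_subst_subset_iff x d T) fun h h' => ?_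
    refine exists_prop_iff (e'.fv_subst_subset_iff x d T) fun k k' => ?_
    simp only [RExp.eval_subst _ _ _ _ _ h h', RExp.eval_subst _ _ _ _ _ k k']
  | deq e e' =>
    refine exists_prop_iff ⟨fun _ => e.fv_subset_domain T, fun _ => DExp.fv_subset_domain _ T⟩
      fun h h' => ?_
    refine exists_prop_iff ⟨fun _ => e'.fv_subset_domain T, fun _ => DExp.fv_subset_domain _ T⟩
      fun k k' => ?_
    rw [DExp.eval_subst _ _ _ _ h h', DExp.eval_subst _ _ _ _ k k']
  | dpred p args =>
    refine exists_prop_iff ⟨fun _ i => (args i).fv_subset_domain T,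
      fun _ i => DExp.fv_subset_domain _ T⟩ fun h h' => ?_
    exact iff_of_eq (congrArg (L.evalPred p) (funext fun i =>
      DExp.eval_subst _ _ _ (args i) (h i) (h' i)))
  | top => exact Iff.rfl
  | bot => exact Iff.rfl
  | and φ ψ ihφ ihψ => exact and_congr ihφ ihψ
  | or φ ψ ihφ ihψ => exact or_congr ihφ ihψ
  | imp φ ψ ihφ ihψ => simp only [Form.subst, sat_full_imp, ihφ, ihψ]
  | sep φ ψ ihφ ihψ => simp only [Form.subst, sat_full_sep, ihφ, ihψ]
  | wand φ ψ ihφ ihψ => simp only [Form.subst, sat_full_wand, ihφ, ihψ]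

/-! ### Runs of loops and of random conditionals -/

theorem sem_dwhile_of_false {k : Kind} {b : DExp L L.bool} {c : Cmd L k} {s : Config L}
    (hb : b.test s.1 = false) : (Cmd.dwhile b c).sem s = Part.some s := by
  refine Part.eq_some_iff.2 (PFun.mem_fix_iff.2 (Or.inl ?_))
  simp [hb]

theorem sem_dwhile_of_true {k : Kind} {b : DExp L L.bool} {c : Cmd L k} {s : Config L}
    (hb : b.test s.1 = true) :
    (Cmd.dwhile b c).sem s = (c.sem s).bind (Cmd.dwhile b c).sem := by
  ext s'
  refine PFun.mem_fix_iff.trans ?_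
  simp only [hb, if_true, Part.mem_map_iff, Part.mem_bind_iff, reduceCtorEq, and_false,
    exists_false, false_or]
  constructor
  · rintro ⟨a, ⟨a', ha', h⟩, ha⟩
    obtain rfl := Sum.inr.inj h
    exact ⟨a', ha', ha⟩
  · rintro ⟨a, ha, h⟩
    exact ⟨a, ⟨a, ha, rfl⟩, h⟩

/-- Induction on the number of iterations of a terminating loop. -/
theorem dwhile_induction {k : Kind} {b : DExp L L.bool} {c : Cmd L k} {s s' : Config L}
    {C : Config L → Prop} (h : s' ∈ (Cmd.dwhile b c).sem s)
    (base : b.test s'.1 = false → C s')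
    (step : ∀ s s₁, b.test s.1 = true → s₁ ∈ c.sem s → s' ∈ (Cmd.dwhile b c).sem s₁ → C s₁ → C s) :
    C s := by
  refine PFun.fixInduction' h (fun s hs => ?_) fun s s₁ hs₁ hs hC => ?_
  · by_cases hb : b.test s.1 = true
    · simp [hb] at hs
    · simp only [Bool.not_eq_true] at hb
      simp only [hb, Bool.false_eq_true, if_false, Part.mem_some_iff, Sum.inl.injEq] at hs
      subst hs
      exact base hb
  · by_cases hb : b.test s.1 = true
    · simp only [hb, if_true, Part.mem_map_iff] at hs
      obtain ⟨a, ha, he⟩ := hs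
      obtain rfl := Sum.inr.inj he
      exact step s _ hb ha hs₁ hC
    · simp [hb] at hs

theorem sem_rcond_of_both {k : Kind} {b : RExp L L.bool} {c c' : Cmd L .rand} {s : Config L}
    (ht : ∃ m ∈ b.event s.1, m ∈ s.2.support) (hf : ∃ m ∈ (b.event s.1)ᶜ, m ∈ s.2.support) :
    (Cmd.rcond b c c' : Cmd L k).sem s =
      (c.sem (s.1, s.2.filter (b.event s.1) ht)).bind fun s₁ =>
        (c'.sem (s.1, s.2.filter (b.event s.1)ᶜ hf)).map fun s₂ =>
          (s₁.1, convComb (s.2.toOuterMeasure (b.event s.1))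
            (toOuterMeasure_le_one _ _) s₁.2 s₂.2) := by
  simp only [Cmd.sem, dif_pos ht, dif_pos hf]

theorem sem_rcond_of_true {k : Kind} {b : RExp L L.bool} {c c' : Cmd L .rand} {s : Config L}
    (h : ∀ m ∈ s.2.support, m ∈ b.event s.1) :
    (Cmd.rcond b c c' : Cmd L k).sem s = c.sem s := by
  obtain ⟨m, hm⟩ := s.2.support_nonempty
  have ht : ∃ m ∈ b.event s.1, m ∈ s.2.support := ⟨m, h m hm, hm⟩
  have hf : ¬ ∃ m ∈ (b.event s.1)ᶜ, m ∈ s.2.support := fun ⟨m, hm, hm'⟩ => hm (h m hm')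
  simp only [Cmd.sem, dif_pos ht, dif_neg hf]
  rw [filter_eq_self _ _ _ h]

theorem sem_rcond_of_false {k : Kind} {b : RExp L L.bool} {c c' : Cmd L .rand} {s : Config L}
    (h : ∀ m ∈ s.2.support, m ∉ b.event s.1) :
    (Cmd.rcond b c c' : Cmd L k).sem s = c'.sem s := by
  have ht : ¬ ∃ m ∈ b.event s.1, m ∈ s.2.support := fun ⟨m, hm, hm'⟩ => h m hm' hm
  simp only [Cmd.sem, dif_neg ht]
  rw [filter_eq_self _ (b.event s.1)ᶜ _ h]

theorem sem_rcond_pure_of_mem {k : Kind} {b : RExp L L.bool} {c c' : Cmd L .rand}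
    {σ : DetM L Set.univ} {m : RanM L Set.univ} (h : m ∈ b.event σ) :
    (Cmd.rcond b c c' : Cmd L k).sem (σ, PMF.pure m) = c.sem (σ, PMF.pure m) :=
  sem_rcond_of_true fun _ h' => (support_pure_unique h').symm ▸ h

theorem sem_rcond_pure_of_notMem {k : Kind} {b : RExp L L.bool} {c c' : Cmd L .rand}
    {σ : DetM L Set.univ} {m : RanM L Set.univ} (h : m ∉ b.event σ) :
    (Cmd.rcond b c c' : Cmd L k).sem (σ, PMF.pure m) = c'.sem (σ, PMF.pure m) :=
  sem_rcond_of_false fun _ h' => (support_pure_unique h').symm ▸ h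

theorem mem_sem_seq {k : Kind} {c c' : Cmd L k} {s s' : Config L} :
    s' ∈ (Cmd.seq c c').sem s ↔ ∃ s₁ ∈ c.sem s, s' ∈ c'.sem s₁ :=
  Part.mem_bind_iff

theorem sem_dcond {k : Kind} {b : DExp L L.bool} {c c' : Cmd L k} {s : Config L} :
    (Cmd.dcond b c c').sem s = if b.test s.1 = true then c.sem s else c'.sem s := by
  simp only [Cmd.sem]

/-! ### The deterministic part of a run -/

theorem fst_eq_of_mem_sem_rand {k : Kind} (c : Cmd L k) (hk : k = .rand) {s s' : Config L}
    (h : s' ∈ c.sem s) : s'.1 = s.1 := by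
  induction c generalizing s s' with
  | skip => rw [Part.mem_some_iff.1 h]
  | dassn x e => cases hk
  | rassn x e => rw [Part.mem_some_iff.1 h]
  | samp x S hS => rw [Part.mem_some_iff.1 h]
  | seq c c' ih ih' =>
    obtain ⟨s₁, h₁, h₂⟩ := mem_sem_seq.1 h
    exact (ih' hk h₂).trans (ih hk h₁)
  | dcond b c c' ih ih' =>
    rw [sem_dcond] at h
    split_ifs at h
    exacts [ih hk h, ih' hk h]
  | rcond b c c' ih ih' =>
    by_cases ht : ∃ m ∈ b.event s.1, m ∈ s.2.support
    · by_cases hf : ∃ m ∈ (b.event s.1)ᶜ, m ∈ s.2.support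
      · rw [sem_rcond_of_both ht hf] at h
        obtain ⟨s₁, h₁, h₂⟩ := Part.mem_bind_iff.1 h
        obtain ⟨s₂, h₂, rfl⟩ := (Part.mem_map_iff _).1 h₂
        exact (ih rfl h₁ :)
      · rw [sem_rcond_of_true] at h
        · exact ih rfl h
        · exact fun m hm => by_contra fun hn => hf ⟨m, hn, hm⟩
    · rw [sem_rcond_of_false] at h
      · exact ih' rfl h
      · exact fun m hm hn => ht ⟨m, hn, hm⟩
  | dwhile b c ih =>
    exact dwhile_induction (C := fun s => s'.1 = s.1) h (fun _ => rfl)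
      fun s s₁ _ h₁ _ hC => hC.trans (ih hk h₁)

/-- The output deterministic memory depends on the input deterministic memory only. -/
theorem fst_eq_of_mem_sem {k : Kind} (c : Cmd L k) {s t s' t' : Config L} (hst : s.1 = t.1)
    (hs : s' ∈ c.sem s) (ht : t' ∈ c.sem t) : s'.1 = t'.1 := by
  induction c generalizing s t s' t' with
  | skip => rw [Part.mem_some_iff.1 hs, Part.mem_some_iff.1 ht, hst]
  | dassn x e =>
    rw [Part.mem_some_iff.1 hs, Part.mem_some_iff.1 ht]
    simp only [hst]
  | rassn x e => rw [Part.mem_some_iff.1 hs, Part.mem_some_iff.1 ht, hst]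
  | samp x S hS => rw [Part.mem_some_iff.1 hs, Part.mem_some_iff.1 ht, hst]
  | seq c c' ih ih' =>
    obtain ⟨s₁, h₁, h₂⟩ := mem_sem_seq.1 hs
    obtain ⟨t₁, k₁, k₂⟩ := mem_sem_seq.1 ht
    exact ih' (ih hst h₁ k₁) h₂ k₂
  | dcond b c c' ih ih' =>
    rw [sem_dcond] at hs ht
    rw [← hst] at ht
    split_ifs at hs ht
    exacts [ih hst hs ht, ih' hst hs ht]
  | rcond b c c' =>
    have key : ∀ {s s' : Config L}, s' ∈ (Cmd.rcond b c c' : Cmd L .rand).sem s → s'.1 = s.1 :=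
      fun h => fst_eq_of_mem_sem_rand _ rfl h
    exact (key hs).trans (hst.trans (key ht).symm)
  | dwhile b c ih =>
    refine dwhile_induction (C := fun s => ∀ t : Config L, s.1 = t.1 →
      t' ∈ (Cmd.dwhile b c).sem t → s'.1 = t'.1) hs ?_ ?_ t hst ht
    · intro hb t hst ht
      rw [sem_dwhile_of_false (hst ▸ hb)] at ht
      rw [Part.mem_some_iff.1 ht, hst]
    · intro s s₁ hb h₁ _ hC t hst ht
      rw [sem_dwhile_of_true (hst ▸ hb)] at ht
      obtain ⟨t₁, k₁, k₂⟩ := Part.mem_bind_iff.1 ht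
      exact hC t₁ (ih hst h₁ k₁) k₂

/-! ### Programs as kernels -/

/-- Over the deterministic memory `σ`, the partial map `f` on configurations is given by a kernel:
it is defined on `(σ, μ)` if and only if it is defined with a common output memory on the point
masses at the support of `μ`, and its output distribution is the mixture of their outputs. -/
def KernelAt (f : Config L → Part (Config L)) (σ : DetM L Set.univ) : Prop :=
  ∀ (μ : PMF (RanM L Set.univ)) (σ' : DetM L Set.univ) (μ' : PMF (RanM L Set.univ)),
    (σ', μ') ∈ f (σ, μ) ↔ ∃ κ : RanM L Set.univ → PMF (RanM L Set.univ),
      (∀ m ∈ μ.support, (σ', κ m) ∈ f (σ, PMF.pure m)) ∧ μ' = μ.bind κ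

theorem KernelAt.congr {f g : Config L → Part (Config L)} {σ : DetM L Set.univ}
    (h : ∀ μ, f (σ, μ) = g (σ, μ)) (hg : KernelAt g σ) : KernelAt f σ := by
  intro μ σ' μ'
  simp only [h]
  exact hg μ σ' μ'

theorem KernelAt.of_eq_some {f : Config L → Part (Config L)} {σ σ₁ : DetM L Set.univ}
    (κ : RanM L Set.univ → PMF (RanM L Set.univ))
    (h : ∀ μ, f (σ, μ) = Part.some (σ₁, μ.bind κ)) : KernelAt f σ := by
  intro μ σ' μ'
  simp only [h, Part.mem_some_iff, Prod.mk.injEq, PMF.pure_bind]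
  constructor
  · rintro ⟨rfl, rfl⟩
    exact ⟨κ, fun _ _ => ⟨rfl, rfl⟩, rfl⟩
  · rintro ⟨κ', hκ, rfl⟩
    obtain ⟨m, hm⟩ := μ.support_nonempty
    exact ⟨(hκ m hm).1, bind_congr_support μ fun m hm => (hκ m hm).2⟩

/-- Kernels compose.  In the converse direction the runs from the individual points must pass
through a common deterministic memory, which is what `hdet` provides. -/
theorem KernelAt.bind {f g : Config L → Part (Config L)} {σ : DetM L Set.univ}
    (hf : KernelAt f σ)
    (hdet : ∀ μ ν s t, s ∈ f (σ, μ) → t ∈ f (σ, ν) → s.1 = t.1)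
    (hg : ∀ μ s, s ∈ f (σ, μ) → KernelAt g s.1) : KernelAt (fun s => (f s).bind g) σ := by
  intro μ σ' μ'
  constructor
  · intro h
    obtain ⟨⟨σ₁, μ₁⟩, h₁, h₂⟩ := Part.mem_bind_iff.1 h
    obtain ⟨κ₁, hκ₁, rfl⟩ := (hf μ σ₁ μ₁).1 h₁
    obtain ⟨κ₂, hκ₂, rfl⟩ := (hg _ _ h₁ _ σ' μ').1 h₂
    refine ⟨fun m => (κ₁ m).bind κ₂, fun m hm => ?_, PMF.bind_bind _ _ _⟩
    refine Part.mem_bind_iff.2 ⟨(σ₁, κ₁ m), hκ₁ m hm, ?_⟩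
    refine (hg _ _ h₁ _ σ' _).2 ⟨κ₂, fun m₁ hm₁ => hκ₂ m₁ ?_, rfl⟩
    exact (PMF.mem_support_bind_iff _ _ _).2 ⟨m, hm, hm₁⟩
  · rintro ⟨κ, hκ, rfl⟩
    obtain ⟨m₀, hm₀⟩ := μ.support_nonempty
    obtain ⟨⟨σ₁, ν₀⟩, hν₀, -⟩ := Part.mem_bind_iff.1 (hκ m₀ hm₀)
    have hn : Nonempty (PMF (RanM L Set.univ)) := ⟨μ⟩
    have h₁ : ∀ m ∈ μ.support, ∃ ν, (σ₁, ν) ∈ f (σ, PMF.pure m) ∧ (σ', κ m) ∈ g (σ₁, ν) := by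
      intro m hm
      obtain ⟨⟨σ₂, ν⟩, hν, hg'⟩ := Part.mem_bind_iff.1 (hκ m hm)
      obtain rfl : σ₁ = σ₂ := hdet _ _ _ _ hν₀ hν
      exact ⟨ν, hν, hg'⟩
    choose! κ₁ hκ₁ hgκ using h₁
    have hfμ : (σ₁, μ.bind κ₁) ∈ f (σ, μ) := (hf _ _ _).2 ⟨κ₁, hκ₁, rfl⟩
    have h₂ : ∀ m₁ ∈ (μ.bind κ₁).support, ∃ ν, (σ', ν) ∈ g (σ₁, PMF.pure m₁) := by
      intro m₁ hm₁
      obtain ⟨m, hm, hm₁⟩ := (PMF.mem_support_bind_iff _ _ _).1 hm₁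
      obtain ⟨κ', hκ', -⟩ := (hg _ _ hfμ _ _ _).1 (hgκ m hm)
      exact ⟨κ' m₁, hκ' m₁ hm₁⟩
    -- The choices of `κ₂` for different `m` agree since `g` is single-valued.
    choose! κ₂ hκ₂ using h₂
    refine Part.mem_bind_iff.2 ⟨_, hfμ, (hg _ _ hfμ _ _ _).2 ⟨κ₂, hκ₂, ?_⟩⟩
    rw [PMF.bind_bind]
    refine bind_congr_support μ fun m hm => ?_
    have hm₂ : (σ', (κ₁ m).bind κ₂) ∈ g (σ₁, κ₁ m) :=
      (hg _ _ hfμ _ _ _).2 ⟨κ₂, fun m₁ hm₁ => hκ₂ m₁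
        ((PMF.mem_support_bind_iff _ _ _).2 ⟨m, hm, hm₁⟩), rfl⟩
    exact congrArg Prod.snd (Part.mem_unique (hgκ m hm) hm₂)

/-- A loop is a kernel: the number of iterations depends on the deterministic memory only, so the
induction follows any one terminating run, and without such a run both sides of the
characterization fail. -/
theorem kernelAt_dwhile {k : Kind} {b : DExp L L.bool} {c : Cmd L k}
    (hc : ∀ σ, KernelAt c.sem σ) (σ : DetM L Set.univ) : KernelAt (Cmd.dwhile b c).sem σ := by
  by_cases h : ∃ ν s', s' ∈ (Cmd.dwhile b c).sem (σ, ν)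
  · obtain ⟨ν, s', hs'⟩ := h
    refine dwhile_induction (C := fun s => KernelAt (Cmd.dwhile b c).sem s.1) hs' ?_ ?_
    · intro hb
      refine KernelAt.of_eq_some (σ₁ := s'.1) PMF.pure fun μ => ?_
      rw [PMF.bind_pure]
      exact sem_dwhile_of_false hb
    · intro s s₁ hb h₁ _ hC
      refine KernelAt.congr (g := fun s => (c.sem s).bind (Cmd.dwhile b c).sem)
        (fun μ => sem_dwhile_of_true hb) ?_
      refine (hc s.1).bind (fun μ ν s' t hs ht =>
        fst_eq_of_mem_sem c (s := (s.1, μ)) (t := (s.1, ν)) rfl hs ht) ?_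
      intro μ t ht
      rw [fst_eq_of_mem_sem c (s := (s.1, μ)) (t := s) rfl ht h₁]
      exact hC
  · intro μ σ' μ'
    refine ⟨fun hμ => (h ⟨_, _, hμ⟩).elim, ?_⟩
    rintro ⟨κ, hκ, -⟩
    obtain ⟨m, hm⟩ := μ.support_nonempty
    exact (h ⟨_, _, hκ m hm⟩).elim

theorem kernelAt_rcond {k : Kind} {b : RExp L L.bool} {c c' : Cmd L .rand}
    {σ : DetM L Set.univ} (hc : KernelAt c.sem σ) (hc' : KernelAt c'.sem σ) :
    KernelAt (Cmd.rcond b c c' : Cmd L k).sem σ := by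
  classical
  intro μ σ' μ'
  by_cases ht : ∃ m ∈ b.event σ, m ∈ μ.support
  · by_cases hf : ∃ m ∈ (b.event σ)ᶜ, m ∈ μ.support
    · rw [sem_rcond_of_both (s := (σ, μ)) ht hf]
      constructor
      · intro h
        obtain ⟨⟨σ₁, ν₁⟩, h₁, h₂⟩ := Part.mem_bind_iff.1 h
        obtain ⟨⟨σ₂, ν₂⟩, h₃, he⟩ := (Part.mem_map_iff _).1 h₂
        have e₁ : σ₁ = σ := fst_eq_of_mem_sem_rand c rfl h₁
        have e₂ : σ₂ = σ := fst_eq_of_mem_sem_rand c' rfl h₃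
        subst e₁ e₂
        simp only [Prod.mk.injEq] at he
        obtain ⟨rfl, rfl⟩ := he
        obtain ⟨κ₁, hκ₁, rfl⟩ := (hc _ _ _).1 h₁
        obtain ⟨κ₂, hκ₂, rfl⟩ := (hc' _ _ _).1 h₃
        refine ⟨fun m => if m ∈ b.event σ₂ then κ₁ m else κ₂ m, fun m hm => ?_, ?_⟩
        · by_cases hb : m ∈ b.event σ₂
          · simp only [if_pos hb]
            rw [sem_rcond_pure_of_mem hb]
            exact hκ₁ m ((PMF.mem_support_filter_iff _).2 ⟨hb, hm⟩)
          · simp only [if_neg hb]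
            rw [sem_rcond_pure_of_notMem hb]
            exact hκ₂ m ((PMF.mem_support_filter_iff _).2 ⟨hb, hm⟩)
        · conv_rhs => rw [← convComb_filter μ _ ht hf, convComb_bind]
          congr 1
          · refine bind_congr_support _ fun m hm => ?_
            rw [if_pos ((PMF.mem_support_filter_iff _).1 hm).1]
          · refine bind_congr_support _ fun m hm => ?_
            rw [if_neg ((PMF.mem_support_filter_iff _).1 hm).1]
      · rintro ⟨κ, hκ, rfl⟩
        have h₁ : (σ', (μ.filter _ ht).bind κ) ∈ c.sem (σ, μ.filter _ ht) := by
          refine (hc _ _ _).2 ⟨κ, fun m hm => ?_, rfl⟩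
          rw [PMF.mem_support_filter_iff] at hm
          have := hκ m hm.2
          rwa [sem_rcond_pure_of_mem hm.1] at this
        have h₂ : (σ', (μ.filter _ hf).bind κ) ∈ c'.sem (σ, μ.filter _ hf) := by
          refine (hc' _ _ _).2 ⟨κ, fun m hm => ?_, rfl⟩
          rw [PMF.mem_support_filter_iff] at hm
          have := hκ m hm.2
          rwa [sem_rcond_pure_of_notMem hm.1] at this
        refine Part.mem_bind_iff.2 ⟨_, h₁, (Part.mem_map_iff _).2 ⟨_, h₂, ?_⟩⟩
        simp only
        rw [← convComb_bind, convComb_filter]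
    · have hT : ∀ m ∈ μ.support, m ∈ b.event σ := fun m hm => by_contra fun hn => hf ⟨m, hn, hm⟩
      rw [sem_rcond_of_true (s := (σ, μ)) hT, hc μ σ' μ']
      refine exists_congr fun κ => and_congr_left fun _ => forall₂_congr fun m hm => ?_
      rw [sem_rcond_pure_of_mem (hT m hm)]
  · have hF : ∀ m ∈ μ.support, m ∉ b.event σ := fun m hm hn => ht ⟨m, hn, hm⟩
    rw [sem_rcond_of_false (s := (σ, μ)) hF, hc' μ σ' μ']
    refine exists_congr fun κ => and_congr_left fun _ => forall₂_congr fun m hm => ?_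
    rw [sem_rcond_pure_of_notMem (hF m hm)]

/-- The semantics of a command is given by kernels: control flow inspects the random memory only
in random conditionals, whose semantics is a mixture. -/
theorem kernelAt_sem {k : Kind} (c : Cmd L k) (σ : DetM L Set.univ) : KernelAt c.sem σ := by
  induction c generalizing σ with
  | skip =>
    exact KernelAt.of_eq_some (σ₁ := σ) PMF.pure fun μ => by rw [PMF.bind_pure]; rfl
  | dassn x e =>
    exact KernelAt.of_eq_some (σ₁ := upd (DVal L) σ x (e.eval σ (subset_domain_univ _))) PMF.pure
      fun μ => by rw [PMF.bind_pure]; rfl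
  | rassn x e =>
    exact KernelAt.of_eq_some (σ₁ := σ)
      (fun m => PMF.pure (upd (RVal L) m x (e.eval σ m (subset_domain_univ _)))) fun μ => rfl
  | samp x S hS =>
    exact KernelAt.of_eq_some (σ₁ := σ)
      (fun m => (PMF.uniformOfFinset S hS).bind fun u => PMF.pure (upd (RVal L) m x u))
      fun μ => rfl
  | seq c c' ih ih' =>
    exact (ih σ).bind (fun μ ν s t hs ht =>
      fst_eq_of_mem_sem c (s := (σ, μ)) (t := (σ, ν)) rfl hs ht) fun μ s _ => ih' s.1
  | dcond b c c' ih ih' =>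
    by_cases hb : b.test σ = true
    · exact KernelAt.congr (fun μ => by rw [sem_dcond, if_pos hb]) (ih σ)
    · exact KernelAt.congr (fun μ => by rw [sem_dcond, if_neg hb]) (ih' σ)
  | rcond b c c' ih ih' => exact kernelAt_rcond (ih σ) (ih' σ)
  | dwhile b c ih => exact kernelAt_dwhile ih σ

/-- A terminating run from `μ` is the mixture of terminating runs from the conditionings of `μ`
on an event and on its complement. -/
theorem exists_mem_sem_filter {k : Kind} (c : Cmd L k) {σ σ' : DetM L Set.univ}
    {μ μ' : PMF (RanM L Set.univ)} (h : (σ', μ') ∈ c.sem (σ, μ)) (B : Set (RanM L Set.univ))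
    (ht : ∃ m ∈ B, m ∈ μ.support) (hf : ∃ m ∈ Bᶜ, m ∈ μ.support) :
    ∃ μ₁ μ₂, (σ', μ₁) ∈ c.sem (σ, μ.filter B ht) ∧ (σ', μ₂) ∈ c.sem (σ, μ.filter Bᶜ hf) ∧
      μ' = convComb (μ.toOuterMeasure B) (toOuterMeasure_le_one _ _) μ₁ μ₂ := by
  obtain ⟨κ, hκ, rfl⟩ := (kernelAt_sem c σ _ _ _).1 h
  refine ⟨(μ.filter B ht).bind κ, (μ.filter Bᶜ hf).bind κ,
    (kernelAt_sem c σ _ _ _).2 ⟨κ, fun m hm => hκ m ?_, rfl⟩,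
    (kernelAt_sem c σ _ _ _).2 ⟨κ, fun m hm => hκ m ?_, rfl⟩, ?_⟩
  · exact ((PMF.mem_support_filter_iff _).1 hm).2
  · exact ((PMF.mem_support_filter_iff _).1 hm).2
  · rw [← convComb_bind, convComb_filter]

/-! ### Unmodified variables -/

theorem sem_unmodified {k : Kind} (c : Cmd L k) {s s' : Config L} (h : s' ∈ c.sem s) :
    (∀ x, Sum.inl x ∉ c.modVars → s'.1 ⟨x, trivial⟩ = s.1 ⟨x, trivial⟩) ∧
      ∀ m' ∈ s'.2.support, ∃ m ∈ s.2.support,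
        ∀ x, Sum.inr x ∉ c.modVars → m' ⟨x, trivial⟩ = m ⟨x, trivial⟩ := by
  induction c generalizing s s' with
  | skip =>
    obtain rfl := Part.mem_some_iff.1 h
    exact ⟨fun _ _ => rfl, fun m hm => ⟨m, hm, fun _ _ => rfl⟩⟩
  | dassn x e =>
    obtain rfl := Part.mem_some_iff.1 h
    refine ⟨fun y hy => upd_of_ne (DVal L) _ _ _ fun hyx => ?_,
      fun m hm => ⟨m, hm, fun _ _ => rfl⟩⟩
    exact hy (by rw [hyx]; rfl)
  | rassn x e =>
    obtain rfl := Part.mem_some_iff.1 h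
    refine ⟨fun _ _ => rfl, fun m' hm' => ?_⟩
    obtain ⟨m, hm, hm'⟩ := (PMF.mem_support_bind_iff _ _ _).1 hm'
    obtain rfl := support_pure_unique hm'
    refine ⟨m, hm, fun y hy => upd_of_ne (RVal L) _ _ _ fun hyx => ?_⟩
    exact hy (by rw [hyx]; rfl)
  | samp x S hS =>
    obtain rfl := Part.mem_some_iff.1 h
    refine ⟨fun _ _ => rfl, fun m' hm' => ?_⟩
    obtain ⟨m, hm, hm'⟩ := (PMF.mem_support_bind_iff _ _ _).1 hm'
    obtain ⟨u, hu, hm'⟩ := (PMF.mem_support_bind_iff _ _ _).1 hm'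
    obtain rfl := support_pure_unique hm'
    refine ⟨m, hm, fun y hy => upd_of_ne (RVal L) _ _ _ fun hyx => ?_⟩
    exact hy (by rw [hyx]; rfl)
  | seq c c' ih ih' =>
    obtain ⟨s₁, h₁, h₂⟩ := mem_sem_seq.1 h
    obtain ⟨hd, hr⟩ := ih h₁
    obtain ⟨hd', hr'⟩ := ih' h₂
    refine ⟨fun x hx => (hd' x fun h => hx (Or.inr h)).trans (hd x fun h => hx (Or.inl h)),
      fun m' hm' => ?_⟩
    obtain ⟨m₁, hm₁, e₁⟩ := hr' m' hm'
    obtain ⟨m, hm, e⟩ := hr m₁ hm₁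
    exact ⟨m, hm, fun x hx => (e₁ x fun h => hx (Or.inr h)).trans (e x fun h => hx (Or.inl h))⟩
  | dcond b c c' ih ih' =>
    rw [sem_dcond] at h
    split_ifs at h
    · obtain ⟨hd, hr⟩ := ih h
      refine ⟨fun x hx => hd x fun h => hx (Or.inl h), fun m' hm' => ?_⟩
      obtain ⟨m, hm, e⟩ := hr m' hm'
      exact ⟨m, hm, fun x hx => e x fun h => hx (Or.inl h)⟩
    · obtain ⟨hd, hr⟩ := ih' h
      refine ⟨fun x hx => hd x fun h => hx (Or.inr h), fun m' hm' => ?_⟩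
      obtain ⟨m, hm, e⟩ := hr m' hm'
      exact ⟨m, hm, fun x hx => e x fun h => hx (Or.inr h)⟩
  | rcond b c c' ih ih' =>
    obtain ⟨σ, μ⟩ := s
    obtain ⟨σ', μ'⟩ := s'
    obtain ⟨κ, hκ, rfl⟩ := (kernelAt_sem _ σ _ _ _).1 h
    have key : ∀ m ∈ μ.support,
        (∀ x, Sum.inl x ∉ c.modVars ∪ c'.modVars → σ' ⟨x, trivial⟩ = σ ⟨x, trivial⟩) ∧
        ∀ m' ∈ (κ m).support, ∀ x, Sum.inr x ∉ c.modVars ∪ c'.modVars →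
          m' ⟨x, trivial⟩ = m ⟨x, trivial⟩ := by
      intro m hm
      have hm' := hκ m hm
      by_cases hb : m ∈ b.event σ
      · rw [sem_rcond_pure_of_mem hb] at hm'
        obtain ⟨hd, hr⟩ := ih hm'
        refine ⟨fun x hx => hd x fun h => hx (Or.inl h), fun m' hm' x hx => ?_⟩
        obtain ⟨m₁, hm₁, e⟩ := hr m' hm'
        obtain rfl := support_pure_unique hm₁
        exact e x fun h => hx (Or.inl h)
      · rw [sem_rcond_pure_of_notMem hb] at hm'
        obtain ⟨hd, hr⟩ := ih' hm'
        refine ⟨fun x hx => hd x fun h => hx (Or.inr h), fun m' hm' x hx => ?_⟩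
        obtain ⟨m₁, hm₁, e⟩ := hr m' hm'
        obtain rfl := support_pure_unique hm₁
        exact e x fun h => hx (Or.inr h)
    obtain ⟨m₀, hm₀⟩ := μ.support_nonempty
    refine ⟨(key m₀ hm₀).1, fun m' hm' => ?_⟩
    obtain ⟨m, hm, hm'⟩ := (PMF.mem_support_bind_iff _ _ _).1 hm'
    exact ⟨m, hm, (key m hm).2 m' hm'⟩
  | dwhile b c ih =>
    refine dwhile_induction (C := fun s =>
      (∀ x, Sum.inl x ∉ c.modVars → s'.1 ⟨x, trivial⟩ = s.1 ⟨x, trivial⟩) ∧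
      ∀ m' ∈ s'.2.support, ∃ m ∈ s.2.support,
        ∀ x, Sum.inr x ∉ c.modVars → m' ⟨x, trivial⟩ = m ⟨x, trivial⟩) h
      (fun _ => ⟨fun _ _ => rfl, fun m hm => ⟨m, hm, fun _ _ => rfl⟩⟩) ?_
    rintro s s₁ - h₁ - ⟨hd', hr'⟩
    obtain ⟨hd, hr⟩ := ih h₁
    refine ⟨fun x hx => (hd' x hx).trans (hd x hx), fun m' hm' => ?_⟩
    obtain ⟨m₁, hm₁, e₁⟩ := hr' m' hm'
    obtain ⟨m, hm, e⟩ := hr m₁ hm₁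
    exact ⟨m, hm, fun x hx => (e₁ x hx).trans (e x hx)⟩

theorem restr_eq_of_mem_support {k : Kind} (c : Cmd L k) {σ σ' : DetM L Set.univ}
    {m : RanM L Set.univ} {ν : PMF (RanM L Set.univ)} (h : (σ', ν) ∈ c.sem (σ, PMF.pure m))
    {V : Set L.RV} (hV : ∀ x ∈ V, Sum.inr x ∉ c.modVars) {m' : RanM L Set.univ}
    (hm' : m' ∈ ν.support) :
    restr (RVal L) (Set.subset_univ V) m' = restr (RVal L) (Set.subset_univ V) m := by
  obtain ⟨m₁, hm₁, e⟩ := (sem_unmodified c h).2 m' hm'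
  obtain rfl := support_pure_unique hm₁
  exact funext fun x => e x (hV x x.2)

theorem marg_eq_of_unmodified {k : Kind} (c : Cmd L k) {s s' : Config L} (h : s' ∈ c.sem s)
    {V : Set L.RV} (hV : ∀ x ∈ V, Sum.inr x ∉ c.modVars) :
    marg (Set.subset_univ V) s'.2 = marg (Set.subset_univ V) s.2 := by
  obtain ⟨σ, μ⟩ := s
  obtain ⟨σ', μ'⟩ := s'
  obtain ⟨κ, hκ, rfl⟩ := (kernelAt_sem _ σ _ _ _).1 h
  rw [marg, PMF.map_bind]
  refine bind_congr_support μ fun m hm => ?_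
  rw [map_congr_support (κ m) (g := Function.const _ (restr (RVal L) (Set.subset_univ V) m))
    fun m' hm' => restr_eq_of_mem_support c (hκ m hm) hV hm', PMF.map_const]
  rfl

/-! ### Dependence of the output on the read variables -/

/-- The distributions have the same marginal on `X`. -/
def SameOn (X : Set L.RV) (μ ν : PMF (RanM L Set.univ)) : Prop :=
  μ.map (restr (RVal L) (Set.subset_univ X)) = ν.map (restr (RVal L) (Set.subset_univ X))

theorem SameOn.mono {X Y : Set L.RV} {μ ν : PMF (RanM L Set.univ)} (h : SameOn Y μ ν)
    (hXY : X ⊆ Y) : SameOn X μ ν := by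
  have := congrArg (PMF.map (restr (RVal L) hXY)) h
  rwa [PMF.map_comp, PMF.map_comp] at this

theorem sameOn_pure {X : Set L.RV} {m m' : RanM L Set.univ}
    (h : restr (RVal L) (Set.subset_univ X) m = restr (RVal L) (Set.subset_univ X) m') :
    SameOn X (PMF.pure m) (PMF.pure m') := by
  rw [SameOn, PMF.pure_map, PMF.pure_map, h]

theorem RExp.eval_eq_of_restr_eq {t : L.Ty} (e : RExp L t) {σ : DetM L Set.univ} {X : Set L.RV}
    (hX : randomVars e.fv ⊆ X) {m m' : RanM L Set.univ}
    (h : restr (RVal L) (Set.subset_univ X) m = restr (RVal L) (Set.subset_univ X) m') :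
    e.eval σ m (subset_domain_univ _) = e.eval σ m' (subset_domain_univ _) :=
  e.eval_congr _ _ (fun _ _ _ _ => rfl) fun x _ _ hx => congrFun h ⟨x, hX hx⟩

theorem restr_upd_eq {X : Set L.RV} {m m' : RanM L Set.univ}
    (h : restr (RVal L) (Set.subset_univ X) m = restr (RVal L) (Set.subset_univ X) m')
    (x : L.RV) (v : RVal L x) {Y : Set L.RV} (hY : Y ⊆ X ∪ {x}) :
    restr (RVal L) (Set.subset_univ Y) (upd (RVal L) m x v) =
      restr (RVal L) (Set.subset_univ Y) (upd (RVal L) m' x v) := by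
  funext ⟨y, hy⟩
  by_cases hyx : y = x
  · subst hyx
    exact (upd_same (RVal L) _ _ _ _).trans (upd_same (RVal L) _ _ _ _).symm
  · refine (upd_of_ne (RVal L) _ _ _ hyx).trans (Eq.trans ?_ (upd_of_ne (RVal L) _ _ _ hyx).symm)
    exact congrFun h ⟨y, (hY hy).resolve_right hyx⟩

/-- The law of the output on `X` and on the variables that are written is determined by the law
of the input on `X`, for every set `X` that contains the variables that are read. -/
theorem sameOn_sem {k : Kind} (c : Cmd L k) {X : Set L.RV} (hX : c.readVars ⊆ X)
    {s t s' t' : Config L} (hst : s.1 = t.1) (hμ : SameOn X s.2 t.2) (hs : s' ∈ c.sem s)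
    (ht : t' ∈ c.sem t) : SameOn (X ∪ c.writeVars) s'.2 t'.2 := by
  induction c generalizing X s t s' t' with
  | skip =>
    obtain rfl := Part.mem_some_iff.1 hs
    obtain rfl := Part.mem_some_iff.1 ht
    exact hμ.mono (Set.union_subset subset_rfl (Set.empty_subset _))
  | dassn x e =>
    obtain rfl := Part.mem_some_iff.1 hs
    obtain rfl := Part.mem_some_iff.1 ht
    exact hμ.mono (Set.union_subset subset_rfl (Set.empty_subset _))
  | rassn x e =>
    obtain rfl := Part.mem_some_iff.1 hs
    obtain rfl := Part.mem_some_iff.1 ht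
    refine map_bind_eq_of_map_eq _ _ _ _ _ _ hμ fun m _ m' _ hmm => ?_
    rw [PMF.pure_map, PMF.pure_map, ← hst, e.eval_eq_of_restr_eq hX hmm]
    exact congrArg PMF.pure (restr_upd_eq hmm x _ (Set.union_subset_union_right _ Set.sdiff_subset))
  | samp x S hS =>
    obtain rfl := Part.mem_some_iff.1 hs
    obtain rfl := Part.mem_some_iff.1 ht
    refine map_bind_eq_of_map_eq _ _ _ _ _ _ hμ fun m _ m' _ hmm => ?_
    rw [PMF.map_bind, PMF.map_bind]
    refine congrArg (PMF.bind _) (funext fun u => ?_)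
    rw [PMF.pure_map, PMF.pure_map]
    exact congrArg PMF.pure (restr_upd_eq hmm x _ subset_rfl)
  | seq c c' ih ih' =>
    obtain ⟨s₁, h₁, h₂⟩ := mem_sem_seq.1 hs
    obtain ⟨t₁, k₁, k₂⟩ := mem_sem_seq.1 ht
    have hX₁ : c.readVars ⊆ X := fun x hx => hX (Or.inl hx)
    have hX₂ : c'.readVars ⊆ X ∪ c.writeVars := fun x hx => by
      by_cases hxw : x ∈ c.writeVars
      · exact Or.inr hxw
      · exact Or.inl (hX (Or.inr ⟨hx, hxw⟩))
    refine (ih' hX₂ (fst_eq_of_mem_sem c hst h₁ k₁) (ih hX₁ hst hμ h₁ k₁) h₂ k₂).mono ?_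
    rintro x (hx | hx | hx)
    · exact Or.inl (Or.inl hx)
    · exact Or.inl (Or.inr hx)
    · exact Or.inr hx.1
  | dcond b c c' ih ih' =>
    rw [sem_dcond] at hs ht
    rw [← hst] at ht
    split_ifs at hs ht
    · exact (ih (fun x hx => hX (Or.inl hx)) hst hμ hs ht).mono
        (Set.union_subset_union_right _ Set.inter_subset_left)
    · exact (ih' (fun x hx => hX (Or.inr hx)) hst hμ hs ht).mono
        (Set.union_subset_union_right _ Set.inter_subset_right)
  | rcond b c c' ih ih' =>
    obtain ⟨σ, μ⟩ := s
    obtain ⟨σ', μ'⟩ := s'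
    obtain ⟨τ, ν⟩ := t
    obtain ⟨τ', ν'⟩ := t'
    obtain rfl : σ = τ := hst
    obtain ⟨κ, hκ, rfl⟩ := (kernelAt_sem _ σ _ _ _).1 hs
    obtain ⟨κ', hκ', rfl⟩ := (kernelAt_sem _ σ _ _ _).1 ht
    refine map_bind_eq_of_map_eq _ _ _ _ _ _ hμ fun m hm m' hm' hmm => ?_
    have k₁ := hκ m hm
    have k₂ := hκ' m' hm'
    have hbX : randomVars b.fv ⊆ X := fun x hx => hX (Or.inl (Or.inl hx))
    have hev : m ∈ b.event σ ↔ m' ∈ b.event σ := by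
      simp only [RExp.event, Set.mem_ofPred_eq, b.eval_eq_of_restr_eq hbX hmm]
    by_cases hb : m ∈ b.event σ
    · rw [sem_rcond_pure_of_mem hb] at k₁
      rw [sem_rcond_pure_of_mem (hev.1 hb)] at k₂
      exact (ih (fun x hx => hX (Or.inl (Or.inr hx))) (s := (σ, PMF.pure m)) (t := (σ, PMF.pure m'))
        rfl (sameOn_pure hmm) k₁ k₂).mono
        (Set.union_subset_union_right _ (Set.sdiff_subset.trans Set.inter_subset_left))
    · rw [sem_rcond_pure_of_notMem hb] at k₁
      rw [sem_rcond_pure_of_notMem (hev.not.1 hb)] at k₂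
      exact (ih' (fun x hx => hX (Or.inr hx)) (s := (σ, PMF.pure m)) (t := (σ, PMF.pure m'))
        rfl (sameOn_pure hmm) k₁ k₂).mono
        (Set.union_subset_union_right _ (Set.sdiff_subset.trans Set.inter_subset_right))
  | dwhile b c ih =>
    refine SameOn.mono (Y := X) ?_ (Set.union_subset subset_rfl (Set.empty_subset _))
    refine dwhile_induction (C := fun s => ∀ t : Config L, s.1 = t.1 → SameOn X s.2 t.2 →
      t' ∈ (Cmd.dwhile b c).sem t → SameOn X s'.2 t'.2) hs ?_ ?_ t hst hμ ht
    · intro hb t hst hμ ht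
      rw [sem_dwhile_of_false (hst ▸ hb)] at ht
      rwa [Part.mem_some_iff.1 ht]
    · intro s s₁ hb h₁ _ hC t hst hμ ht
      rw [sem_dwhile_of_true (hst ▸ hb)] at ht
      obtain ⟨t₁, k₁, k₂⟩ := Part.mem_bind_iff.1 ht
      exact hC t₁ (fst_eq_of_mem_sem c hst h₁ k₁)
        ((ih hX hst hμ h₁ k₁).mono Set.subset_union_left) k₂

theorem writeVars_subset_modVars {k : Kind} (c : Cmd L k) {x : L.RV} (hx : x ∈ c.writeVars) :
    Sum.inr x ∈ c.modVars := by
  induction c with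
  | skip => exact hx.elim
  | dassn y e => exact hx.elim
  | rassn y e => exact congrArg Sum.inr hx.1
  | samp y S hS => exact congrArg Sum.inr hx
  | seq c c' ih ih' => exact hx.imp ih fun h => ih' h.1
  | dcond b c c' ih ih' => exact Or.inl (ih hx.1)
  | rcond b c c' ih ih' => exact Or.inl (ih hx.1.1)
  | dwhile b c ih => exact hx.elim

/-! ### Conditioning and mixing separating conjunctions -/

theorem RExp.mem_event {b : RExp L L.bool} {σ : DetM L Set.univ} {m : RanM L Set.univ} :
    m ∈ b.event σ ↔ b.eval σ m (subset_domain_univ _) = L.boolEquiv.symm true :=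
  L.boolEquiv.eq_symm_apply.symm

theorem RExp.mem_compl_event {b : RExp L L.bool} {σ : DetM L Set.univ} {m : RanM L Set.univ} :
    m ∈ (b.event σ)ᶜ ↔ b.eval σ m (subset_domain_univ _) = L.boolEquiv.symm false := by
  rw [L.boolEquiv.eq_symm_apply, ← Bool.not_eq_true]
  rfl

theorem sat_sep_filter {φ : Form L} {b : RExp L L.bool} {v : Bool} {σ : DetM L Set.univ}
    {μ : PMF (RanM L Set.univ)} (h : Sat (full σ μ) (.sep φ (.defd b))) {B : Set (RanM L Set.univ)}
    (hB : ∀ m, m ∈ B ↔ b.eval σ m (subset_domain_univ _) = L.boolEquiv.symm v)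
    (hμ : ∃ m ∈ B, m ∈ μ.support) : Sat (full σ (μ.filter B hμ)) (.sep φ (.ris b v)) := by
  rw [sat_full_sep] at h ⊢
  obtain ⟨T₁, T₂, h₁, h₂, hd, hi, hφ, hb, -, -⟩ := h
  have hBt : ∀ m, m ∈ B ↔ restr (RVal L) h₂ m ∈ {n | b.eval σ n hb = L.boolEquiv.symm v} :=
    fun m => (hB m).trans (iff_of_eq (congrArg (· = _)
      (b.eval_congr _ _ (fun _ _ _ _ => rfl) fun _ _ _ _ => rfl)))
  obtain ⟨hi', he⟩ := hi.filter B _ hBt hμ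
  refine ⟨T₁, T₂, h₁, h₂, hd, hi', ?_, hb, Set.empty_subset _, fun n hn => ?_⟩
  · rw [marg, he]
    exact hφ
  · obtain ⟨m, hm, rfl⟩ := (PMF.mem_support_map_iff _ _ _).1 hn
    exact (hBt m).1 ((PMF.mem_support_filter_iff _).1 hm).1

theorem sat_sep_ris {φ : Form L} {b : RExp L L.bool} {v : Bool} {σ : DetM L Set.univ}
    {μ : PMF (RanM L Set.univ)} (h : Sat (full σ μ) (.sep φ (.defd b))) {B : Set (RanM L Set.univ)}
    (hB : ∀ m, m ∈ B ↔ b.eval σ m (subset_domain_univ _) = L.boolEquiv.symm v)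
    (hμ : ∀ m ∈ μ.support, m ∈ B) : Sat (full σ μ) (.sep φ (.ris b v)) := by
  obtain ⟨m, hm⟩ := μ.support_nonempty
  have := sat_sep_filter h hB ⟨m, hμ m hm, hm⟩
  rwa [filter_eq_self _ _ _ hμ] at this

theorem sat_sep_defd {ψ : Form L} {b : RExp L L.bool} {v : Bool} {σ : DetM L Set.univ}
    {T : Set L.RV} {μ : PMF (RanM L T)} (h : Sat (full σ μ) (.sep ψ (.ris b v))) :
    Sat (full σ μ) (.sep ψ (.defd b)) := by
  rw [sat_full_sep] at h ⊢
  obtain ⟨T₁, T₂, h₁, h₂, hd, hi, hψ, hb, -, -⟩ := h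
  exact ⟨T₁, T₂, h₁, h₂, hd, hi, hψ, hb, hb, fun _ _ => rfl⟩

/-- For a supported formula `ψ`, the formula `ψ * D[b]` is closed under mixtures: both
distributions have the least model of `ψ` as a marginal, and mixing two products with a common
factor is mixing the other factor. -/
theorem Form.Supported.sat_convComb {ψ : Form L} (hψ : ψ.Supported) {b : RExp L L.bool}
    {σ : DetM L Set.univ} {μ₁ μ₂ : PMF (RanM L Set.univ)} (ρ : ℝ≥0∞) (hρ : ρ ≤ 1)
    (h₁ : Sat (full σ μ₁) (.sep ψ (.defd b))) (h₂ : Sat (full σ μ₂) (.sep ψ (.defd b))) :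
    Sat (full σ (convComb ρ hρ μ₁ μ₂)) (.sep ψ (.defd b)) := by
  rw [sat_full_sep] at h₁ h₂ ⊢
  obtain ⟨T, μ, hmin⟩ := hψ σ
  obtain ⟨T₁, U₁, hT₁, hU₁, hd₁, hi₁, hψ₁, hb₁, -, -⟩ := h₁
  obtain ⟨T₂, U₂, hT₂, hU₂, hd₂, hi₂, hψ₂, hb₂, -, -⟩ := h₂
  obtain ⟨hsat, hTT₁, e₁⟩ := hmin T₁ _ hψ₁
  obtain ⟨-, hTT₂, e₂⟩ := hmin T₂ _ hψ₂
  have hbU₁ : randomVars b.fv ⊆ U₁ := subset_domain_univ_iff.1 hb₁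
  have hbU₂ : randomVars b.fv ⊆ U₂ := subset_domain_univ_iff.1 hb₂
  have k₁ : μ₁.map (restr (RVal L) (Set.subset_univ T)) = μ :=
    (marg_marg hTT₁ hT₁ μ₁).symm.trans e₁.symm
  have k₂ : μ₂.map (restr (RVal L) (Set.subset_univ T)) = μ :=
    (marg_marg hTT₂ hT₂ μ₂).symm.trans e₂.symm
  have i₁ := indep_restr_mono hi₁ hTT₁ hbU₁
  have i₂ := indep_restr_mono hi₂ hTT₂ hbU₂
  rw [Indep, k₁] at i₁
  rw [Indep, k₂] at i₂
  have key := convComb_map ρ hρ μ₁ μ₂ fun m =>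
    (restr (RVal L) (Set.subset_univ T) m, restr (RVal L) (Set.subset_univ (randomVars b.fv)) m)
  rw [i₁, i₂, convComb_indepProd_right] at key
  obtain ⟨hi, e, -⟩ := Indep.of_map_eq key
  have hb : b.fv ⊆ domain Set.univ (randomVars b.fv) := subset_domain_univ_iff.2 subset_rfl
  refine ⟨T, randomVars b.fv, Set.subset_univ _, Set.subset_univ _, hd₁.mono hTT₁ hbU₁, hi, ?_,
    hb, hb, fun _ _ => rfl⟩
  rw [marg, e]
  exact hsat

/-! ### Soundness of the rules -/

/-- Partial correctness: every output that the command produces from an input satisfying `φ`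
satisfies `ψ`. -/
def PartialValid {k : Kind} (φ : Form L) (c : Cmd L k) (ψ : Form L) : Prop :=
  ∀ s s' : Config L, Sat (full s.1 s.2) φ → s' ∈ c.sem s → Sat (full s'.1 s'.2) ψ

theorem partialValid_dwhile {k : Kind} {φ : Form L} {b : DExp L L.bool} {c : Cmd L k}
    (hc : PartialValid (.and φ (.dis b true)) c φ) :
    PartialValid φ (.dwhile b c) (.and φ (.dis b false)) := by
  intro s s' hs hs'
  refine dwhile_induction (C := fun s => Sat (full s.1 s.2) φ →
    Sat (full s'.1 s'.2) (.and φ (.dis b false))) hs' ?_ ?_ hs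
  · intro hb h
    exact ⟨h, subset_domain_univ _, subset_domain_univ _,
      L.boolEquiv.eq_symm_apply.2 hb⟩
  · intro s s₁ hb h₁ _ hC h
    exact hC (hc s s₁ ⟨h, subset_domain_univ _, subset_domain_univ _,
      L.boolEquiv.eq_symm_apply.2 hb⟩ h₁)

theorem partialValid_rassn {k : Kind} (x : L.RV) (e : RExp L (L.rty x)) (hx : Sum.inr x ∉ e.fv) :
    PartialValid .top (.rassn x e : Cmd L k) (.eqv (.var x) e) := by
  intro s s' _ hs'
  obtain rfl := Part.mem_some_iff.1 hs'
  refine ⟨subset_domain_univ _, subset_domain_univ _, fun m' hm' => ?_⟩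
  obtain ⟨m, hm, hm'⟩ := (PMF.mem_support_bind_iff _ _ _).1 hm'
  obtain rfl := support_pure_unique hm'
  refine (upd_same (RVal L) _ _ _ _).trans ?_
  refine e.eval_congr _ _ (fun _ _ _ _ => rfl) fun y _ _ hy => ?_
  refine (upd_of_ne (RVal L) _ _ _ fun hyx => ?_).symm
  exact hx (hyx ▸ hy)

theorem partialValid_samp {k : Kind} (x : L.RV) (S : Finset (L.Val (L.rty x))) (hS : S.Nonempty) :
    PartialValid .top (.samp x S hS : Cmd L k) (.unif S hS (.var x)) := by
  intro s s' _ hs'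
  obtain rfl := Part.mem_some_iff.1 hs'
  refine ⟨subset_domain_univ _, fun v hv => ?_⟩
  rw [← PMF.uniformOfFinset_apply_of_mem hS hv]
  congr 1
  simp only [PMF.map_bind, PMF.pure_map, RExp.eval]
  refine Eq.trans ?_ (PMF.bind_const s.2 _)
  refine congrArg s.2.bind (funext fun m => Eq.trans ?_ (PMF.bind_pure _))
  exact congrArg (PMF.bind _) (funext fun u => congrArg PMF.pure (upd_same (RVal L) _ _ _ _))

theorem partialValid_rcond_of_det {k : Kind} {φ ψ : Form L} {b : RExp L L.bool}
    {c c' : Cmd L .rand} (hc : PartialValid (.and φ (.ris b true)) c ψ)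
    (hc' : PartialValid (.and φ (.ris b false)) c' ψ)
    (hb : (Form.imp φ (.or (.ris b true) (.ris b false))).Valid) :
    PartialValid φ (.rcond b c c' : Cmd L k) ψ := by
  intro s s' hs hs'
  rcases hb (full s.1 s.2) (full s.1 s.2) (World.le_refl _) hs with h | h
  · have h' := h
    obtain ⟨_, _, h'⟩ := h'
    rw [sem_rcond_of_true fun m hm => RExp.mem_event.2 (h' m hm)] at hs'
    exact hc s s' ⟨hs, h⟩ hs'
  · have h' := h
    obtain ⟨_, _, h'⟩ := h'
    rw [sem_rcond_of_false fun m hm => RExp.mem_compl_event.2 (h' m hm)] at hs'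
    exact hc' s s' ⟨hs, h⟩ hs'

/-- A random conditional, with the postconditions `χ₁` and `χ₂` of the branches: the guard is
independent of `φ`, so that `φ` survives conditioning on the guard. -/
theorem partialValid_rcond {k : Kind} {φ ψ χ₁ χ₂ : Form L} {b : RExp L L.bool}
    {c c' : Cmd L .rand} (hc : PartialValid (.sep φ (.ris b true)) c χ₁)
    (hc' : PartialValid (.sep φ (.ris b false)) c' χ₂)
    (h₁ : ∀ (σ : DetM L Set.univ) (μ : PMF (RanM L Set.univ)),
      Sat (full σ μ) χ₁ → Sat (full σ μ) ψ)
    (h₂ : ∀ (σ : DetM L Set.univ) (μ : PMF (RanM L Set.univ)),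
      Sat (full σ μ) χ₂ → Sat (full σ μ) ψ)
    (hmix : ∀ (σ : DetM L Set.univ) (μ₁ μ₂ : PMF (RanM L Set.univ)) (ρ : ℝ≥0∞) (hρ : ρ ≤ 1),
      Sat (full σ μ₁) ψ → Sat (full σ μ₂) ψ → Sat (full σ (convComb ρ hρ μ₁ μ₂)) ψ) :
    PartialValid (.sep φ (.defd b)) (.rcond b c c' : Cmd L k) ψ := by
  intro s s' hs hs'
  by_cases ht : ∃ m ∈ b.event s.1, m ∈ s.2.support
  · by_cases hf : ∃ m ∈ (b.event s.1)ᶜ, m ∈ s.2.support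
    · rw [sem_rcond_of_both ht hf] at hs'
      obtain ⟨s₁, hs₁, hs'⟩ := Part.mem_bind_iff.1 hs'
      obtain ⟨s₂, hs₂, rfl⟩ := (Part.mem_map_iff _).1 hs'
      have k₁ := h₁ _ _ (hc _ _ (sat_sep_filter hs (fun _ => RExp.mem_event) ht) hs₁)
      have k₂ := h₂ _ _ (hc' _ _ (sat_sep_filter hs (fun _ => RExp.mem_compl_event) hf) hs₂)
      have e : s₂.1 = s₁.1 :=
        (fst_eq_of_mem_sem_rand c' rfl hs₂).trans (fst_eq_of_mem_sem_rand c rfl hs₁).symm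
      rw [e] at k₂
      exact hmix _ _ _ _ (toOuterMeasure_le_one _ _) k₁ k₂
    · have hT : ∀ m ∈ s.2.support, m ∈ b.event s.1 :=
        fun m hm => by_contra fun hn => hf ⟨m, hn, hm⟩
      rw [sem_rcond_of_true hT] at hs'
      exact h₁ _ _ (hc _ _ (sat_sep_ris hs (fun _ => RExp.mem_event) hT) hs')
  · have hF : ∀ m ∈ s.2.support, m ∉ b.event s.1 := fun m hm hn => ht ⟨m, hn, hm⟩
    rw [sem_rcond_of_false hF] at hs'
    exact h₂ _ _ (hc' _ _ (sat_sep_ris hs (fun _ => RExp.mem_compl_event) hF) hs')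

theorem partialValid_rcase {k : Kind} {φ ψ : Form L} {b : RExp L L.bool} {c : Cmd L k}
    (ht : PartialValid (.sep φ (.ris b true)) c (.sep ψ (.ris b true)))
    (hf : PartialValid (.sep φ (.ris b false)) c (.sep ψ (.ris b false))) (hψ : ψ.Supported) :
    PartialValid (.sep φ (.defd b)) c (.sep ψ (.defd b)) := by
  rintro ⟨σ, μ⟩ ⟨σ', μ'⟩ hs hs'
  by_cases hT : ∃ m ∈ b.event σ, m ∈ μ.support
  · by_cases hF : ∃ m ∈ (b.event σ)ᶜ, m ∈ μ.support
    · obtain ⟨μ₁, μ₂, k₁, k₂, rfl⟩ := exists_mem_sem_filter c hs' (b.event σ) hT hF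
      exact hψ.sat_convComb _ (toOuterMeasure_le_one _ _)
        (sat_sep_defd (ht _ _ (sat_sep_filter hs (fun _ => RExp.mem_event) hT) k₁))
        (sat_sep_defd (hf _ _ (sat_sep_filter hs (fun _ => RExp.mem_compl_event) hF) k₂))
    · exact sat_sep_defd (ht _ _ (sat_sep_ris hs (fun _ => RExp.mem_event)
        fun m hm => by_contra fun hn => hF ⟨m, hn, hm⟩) hs')
  · exact sat_sep_defd (hf _ _ (sat_sep_ris hs (fun _ => RExp.mem_compl_event)
      fun m hm hn => hT ⟨m, hn, hm⟩) hs')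

theorem sat_marg_of_unmodified {k : Kind} {c : Cmd L k} {η : Form L} (hη : Disjoint η.fv c.modVars)
    {s s' : Config L} (hs' : s' ∈ c.sem s) {V : Set L.RV} (hV : ∀ x ∈ V, Sum.inr x ∉ c.modVars)
    (hs : Sat (full s.1 (marg (Set.subset_univ V) s.2)) η) :
    Sat (full s'.1 (marg (Set.subset_univ V) s'.2)) η := by
  rw [marg_eq_of_unmodified c hs' hV]
  exact sat_congr_det (fun x hx => ((sem_unmodified c hs').1 x
    (Set.disjoint_left.1 hη hx)).symm) hs

theorem partialValid_const {k : Kind} {φ ψ η : Form L} {c : Cmd L k} (hc : PartialValid φ c ψ)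
    (hη : Disjoint η.fv c.modVars) : PartialValid (.and φ η) c (.and ψ η) := by
  intro s s' hs hs'
  refine ⟨hc s s' hs.1 hs', sat_of_sat_marg (sat_marg_of_unmodified hη hs'
    (V := randomVars η.fv) (fun x hx => Set.disjoint_left.1 hη hx) (sat_marg _ ?_ hs.2))⟩
  exact Set.inter_subset_right

theorem partialValid_frame {k : Kind} {φ ψ η : Form L} {c : Cmd L k} (T : Set L.RV)
    (hc : PartialValid φ c ψ) (hη : Disjoint η.fv c.modVars)
    (hψ : randomVars ψ.fv ⊆ T ∪ c.readVars ∪ c.writeVars)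
    (hφ : ∀ x ∈ T ∪ c.readVars, (Form.imp φ (.defd (.var x))).Valid) :
    PartialValid (.sep φ η) c (.sep ψ η) := by
  rintro ⟨σ, μ⟩ ⟨σ', μ'⟩ hs hs'
  rw [sat_full_sep] at hs ⊢
  obtain ⟨T₁, T₂, h₁, h₂, hd, hi, hsφ, hsη⟩ := hs
  have hR : T ∪ c.readVars ⊆ T₁ := fun x hx => by
    obtain ⟨hx, -⟩ := hφ x hx _ _ (World.le_refl _) hsφ
    exact hx rfl
  -- Variables of `T₂` that are not free in `η` may be written by `c`; they are dropped.
  let U : Set L.RV := T₂ ∩ randomVars η.fv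
  have hU : ∀ x ∈ U, Sum.inr x ∉ c.modVars := fun x hx => Set.disjoint_left.1 hη hx.2
  have hUT : U ⊆ T₂ := Set.inter_subset_left
  have hi' := indep_restr_mono hi hR hUT
  refine ⟨T ∪ c.readVars ∪ c.writeVars, U, Set.subset_univ _, Set.subset_univ _, ?_, ?_, ?_, ?_⟩
  · refine Set.disjoint_left.2 fun x hx hxU => ?_
    rcases hx with hx | hx
    · exact Set.disjoint_left.1 hd (hR hx) hxU.1
    · exact hU x hxU (writeVars_subset_modVars c hx)
  · obtain ⟨κ, hκ, rfl⟩ := (kernelAt_sem c σ _ _ _).1 hs'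
    refine hi'.bind κ _ _ id (fun m hm m' hm' hmm => ?_) fun m hm m' hm' =>
      restr_eq_of_mem_support c (hκ m hm) hU hm'
    exact sameOn_sem c Set.subset_union_right (s := (σ, PMF.pure m)) (t := (σ, PMF.pure m')) rfl
      (sameOn_pure hmm) (hκ m hm) (hκ m' hm')
  · exact sat_marg _ (Set.inter_subset_right.trans hψ) (hc _ _ (sat_of_sat_marg hsφ) hs')
  · have := sat_marg (V := U) hUT (fun x hx => hx) hsη
    rw [marg_marg] at this
    exact sat_marg_of_unmodified hη hs' hU this

/-- Every derivable judgment is partially correct.  Partial correctness, unlike validity, is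
preserved by the rules without assumptions on the termination of subprograms. -/
theorem Derivable.partialValid {k : Kind} {φ ψ : Form L} {c : Cmd L k} (h : Derivable φ c ψ) :
    PartialValid φ c ψ := by
  induction h with
  | dassn ψ x e =>
    intro s s' hs hs'
    obtain rfl := Part.mem_some_iff.1 hs'
    exact (sat_subst x e).1 hs
  | skip φ =>
    intro s s' hs hs'
    obtain rfl := Part.mem_some_iff.1 hs'
    exact hs
  | seqn _ _ ih ih' =>
    intro s s' hs hs'
    obtain ⟨s₁, h₁, h₂⟩ := mem_sem_seq.1 hs'
    exact ih' _ _ (ih _ _ hs h₁) h₂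
  | dcond _ _ ih ih' =>
    intro s s' hs hs'
    rw [sem_dcond] at hs'
    split_ifs at hs' with hb
    · exact ih s s' ⟨hs, subset_domain_univ _, subset_domain_univ _,
        L.boolEquiv.eq_symm_apply.2 hb⟩ hs'
    · exact ih' s s' ⟨hs, subset_domain_univ _, subset_domain_univ _,
        L.boolEquiv.eq_symm_apply.2 (Bool.not_eq_true _ ▸ hb)⟩ hs'
  | dloop _ ih => exact partialValid_dwhile ih
  | rassn x e hx => exact partialValid_rassn x e hx
  | rsamp x S hS => exact partialValid_samp x S hS
  | rdcond _ _ hb ih ih' => exact partialValid_rcond_of_det ih ih' hb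
  | rcond _ _ hψ ih ih' =>
    exact partialValid_rcond ih ih' (fun _ _ => sat_sep_defd) (fun _ _ => sat_sep_defd)
      fun _ _ _ ρ hρ => hψ.sat_convComb ρ hρ
  | rcondCM _ _ hψ ih ih' =>
    exact partialValid_rcond ih ih' (fun _ _ => id) (fun _ _ => id)
      fun σ μ₁ μ₂ ρ hρ => hψ σ Set.univ μ₁ μ₂ ρ hρ
  | weak _ hw ih =>
    intro s s' hs hs'
    exact (hw (full s'.1 s'.2)).2 _ (World.le_refl _)
      (ih s s' ((hw (full s.1 s.2)).1 _ (World.le_refl _) hs) hs')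
  | true c => exact fun _ _ _ _ => trivial
  | conj _ _ ih ih' => exact fun s s' hs hs' => ⟨ih s s' hs.1 hs', ih' s s' hs.2 hs'⟩
  | case _ _ ih ih' =>
    exact fun s s' hs hs' => hs.imp (fun h => ih s s' h hs') fun h => ih' s s' h hs'
  | rcase _ _ hψ ih ih' => exact partialValid_rcase ih ih' hψ
  | const _ hη ih => exact partialValid_const ih hη
  | frame T _ hη hψ hφ ih => exact partialValid_frame T ih hη hψ hφ

end PSL

theorem mainTheorem1 (L : Sig) (k : PSL.Kind) (φ ψ : PSL.Form L) (c : PSL.Cmd L k)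
    (hc : c.Terminates) (h : PSL.Derivable φ c ψ) : PSL.Valid φ c ψ :=
  fun s hs => ⟨(c.sem s).get (hc s), Part.get_mem _,
    h.partialValid s _ hs (Part.get_mem _)⟩
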